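/- \textbf{Theorem (Distributionally robust linear classification).} Let $n\ge 0$ and $N\ge 1$ be integers, let $\mathbb X\subseteq\mathbb R^n$ be closed and convex, let $\|\cdot\|$ be a norm on $\mathbb R^n$ with dual norm $\|\bm w\|_*=\sup\{\langle \bm w,\bm x\rangle:\|\bm x\|\le 1\}$, and let $0<\kappa<\infty$ and $\rho\ge 0$. Let $(\widehat{\bm x}_i,\widehat y_i)\in\Xi:=\mathbb X\times\{+1,-1\}$, $i=1,\dots,N$, be training samples with empirical distribution $\widehat{\mathbb P}_N=\frac1N\sum_{i=1}^N\delta_{(\widehat{\bm x}_i,\widehat y_i)}$. For the transportation cost $d((\bm x,y),(\bm x',y'))=\|\bm x-\bm x'\|+\kappa\,\mathbf 1_{\{y\ne y'\}}$ let $W(\mathbb Q,\mathbb Q')$ be the infimum of $\int d\,\mathrm d\Pi$ over all joint distributions $\Pi$ with marginals $\mathbb Q$ and $\mathbb Q'$, and let $\mathbb B_\rho(\widehat{\mathbb P}_N)$ be the set of all probability distributions $\mathbb Q$ with $\mathbb Q(\Xi)=1$ and $W(\mathbb Q,\widehat{\mathbb P}_N)\le\rho$. For a convex function $L:\mathbb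 R\to\mathbb R$ consider the distributionally robust problem $$\inf_{\bm w\in\mathbb R^n}\ \sup_{\mathbb Q\in\mathbb B_\rho(\widehat{\mathbb P}_N)}\ \mathbb E^{\mathbb Q}\big[L(y\langle\bm w,\bm x\rangle)\big].\tag{P}$$ (i) If $L(z)=\max_{1\le j\le J}\{a_jz+b_j\}$ with $J\ge 1$ and $a_j,b_j\in\mathbb R$, then (P) is equivalent to $$\begin{array}{cll}\displaystyle\inf_{\bm w,\lambda,s_i,\bm p^+_{ij},\bm p^-_{ij}}&\displaystyle\lambda\rho+\frac1N\sum_{i=1}^Ns_i\\ \text{s.t.}&S_{\mathbb X}(a_j\widehat y_i\bm w-\bm p^+_{ij})+b_j+\langle\bm p^+_{ij},\widehat{\bm x}_i\rangle\le s_i&\forall i\le N,\ j\le J\\ &S_{\mathbb X}(-a_j\widehat y_i\bm w-\bm p^-_{ij})+b_j+\langle\bm p^-_{ij},\widehat{\bm x}_i\rangle-\kappa\lambda\le s_i&\forall i\le N,\ j\le J\\ &\|\bm p^+_{ij}\|_*\le\lambda,\quad\|\bm p^-_{ij}\|_*\le\lambda&\forall i\le N,\ j\le J,\end{array}$$ where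 $S_{\mathbb X}(\bm z)=\sup\{\langle\bm x,\bm z\rangle:\bm x\in\mathbb X\}$ is the support function of $\mathbb X$. (ii) If $\mathbb X=\mathbb R^n$ and $L$ is Lipschitz continuous with Lipschitz modulus $\mathrm{lip}(L)=\sup_{z\ne z'}|L(z)-L(z')|/|z-z'|$, then (P) is equivalent to $$\begin{array}{cll}\displaystyle\inf_{\bm w,\lambda,s_i}&\displaystyle\lambda\rho+\frac1N\sum_{i=1}^Ns_i\\ \text{s.t.}&L(\widehat y_i\langle\bm w,\widehat{\bm x}_i\rangle)\le s_i&\forall i\le N\\ &L(-\widehat y_i\langle\bm w,\widehat{\bm x}_i\rangle)-\kappa\lambda\le s_i&\forall i\le N\\ &\mathrm{lip}(L)\,\|\bm w\|_*\le\lambda.\end{array}$$ In both cases the expectations in (P) exist and are finite, and the reformulation is a convex program (convex feasible set, convex objective). ``Equivalent'' means: for every fixed $\bm w$ the worst-case expected loss $\sup_{\mathbb Q\in\mathbb B_\rho(\widehat{\mathbb P}_N)}\mathbb E^{\mathbb Q}[L(y\langle\bm w,\bm x\rangle)]$ equals the infimum of the program over its remaining variables; the optimal values (possibly $-\infty$)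 of the two problems coincide; and $\bm w$ is optimal in (P) if and only if it is the $\bm w$-component of an optimal solution of the program. -/

import Mathlib

open MeasureTheory
open scoped ENNReal

namespace DRClassification

/-- The space `ℝⁿ` with its standard inner product; it contains inputs `x` and weights `w`. -/
abbrev Vec (n : ℕ) : Type := EuclideanSpace ℝ (Fin n)

/-- The input-output set `Ξ = X × {+1, -1}`, as a subset of `ℝⁿ × ℝ`. -/
def inputOutput {n : ℕ} (X : Set (Vec n)) : Set (Vec n × ℝ) :=
  X ×ˢ ({1, -1} : Set ℝ)

/-- The dual norm `‖w‖_* = sup {⟨w, x⟩ : ‖x‖ ≤ 1}` of a norm `nrm` on `ℝⁿ`. -/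
noncomputable def dualNorm {n : ℕ} (nrm : Seminorm ℝ (Vec n)) (w : Vec n) : ℝ :=
  sSup {r : ℝ | ∃ x : Vec n, nrm x ≤ 1 ∧ r = inner ℝ w x}

/-- The support function `S_X(z) = sup {⟨x, z⟩ : x ∈ X}`, with values in `[-∞, ∞]`. -/
noncomputable def supportFun {n : ℕ} (X : Set (Vec n)) (z : Vec n) : EReal :=
  ⨆ x ∈ X, ((inner ℝ x z : ℝ) : EReal)

/-- The Lipschitz modulus of a univariate function. -/
noncomputable def lipModulus (L : ℝ → ℝ) : ℝ :=
  sSup {r : ℝ | ∃ z z' : ℝ, z ≠ z' ∧ r = |L z - L z'| / |z - z'|}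

/-- The transportation cost `d((x, y), (x', y')) = ‖x - x'‖ + κ 1{y ≠ y'}`. -/
noncomputable def transportCost {n : ℕ} (nrm : Seminorm ℝ (Vec n)) (κ : ℝ)
    (ξ ξ' : Vec n × ℝ) : ℝ :=
  nrm (ξ.1 - ξ'.1) + κ * (if ξ.2 ≠ ξ'.2 then 1 else 0)

/-- The Wasserstein distance: the infimum of the expected transportation cost over all joint
distributions `π` with marginals `Q` and `Q'`. -/
noncomputable def wasserstein {n : ℕ} (nrm : Seminorm ℝ (Vec n)) (κ : ℝ)
    (Q Q' : Measure (Vec n × ℝ)) : ℝ≥0∞ :=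
  ⨅ π ∈ {π : Measure ((Vec n × ℝ) × (Vec n × ℝ)) | π.fst = Q ∧ π.snd = Q'},
    ∫⁻ ζ, ENNReal.ofReal (transportCost nrm κ ζ.1 ζ.2) ∂π

/-- The empirical distribution, i.e. the uniform distribution on the training samples. -/
noncomputable def empirical {n N : ℕ} (xhat : Fin N → Vec n) (yhat : Fin N → ℝ) :
    Measure (Vec n × ℝ) :=
  (N : ℝ≥0∞)⁻¹ • ∑ i, Measure.dirac (xhat i, yhat i)

/-- The Wasserstein ball of radius `ρ` around `P`: all probability distributions `Q` with
`Q(Ξ) = 1` whose Wasserstein distance from `P` is at most `ρ`. -/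
def wassersteinBall {n : ℕ} (X : Set (Vec n)) (nrm : Seminorm ℝ (Vec n)) (κ ρ : ℝ)
    (P : Measure (Vec n × ℝ)) : Set (Measure (Vec n × ℝ)) :=
  {Q | IsProbabilityMeasure Q ∧ Q (inputOutput X) = 1 ∧
    wasserstein nrm κ Q P ≤ ENNReal.ofReal ρ}

/-- The loss `L(y⟨w, x⟩)` of the linear hypothesis `w` on the input-output pair `ξ = (x, y)`. -/
noncomputable def classLoss {n : ℕ} (L : ℝ → ℝ) (w : Vec n) (ξ : Vec n × ℝ) : ℝ :=
  L (ξ.2 * inner ℝ w ξ.1)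

/-- The worst-case expected loss of `w` over a set `B` of distributions: the objective function
of the distributionally robust problem, which minimizes it over all `w`. -/
noncomputable def worstCaseLoss {n : ℕ} (L : ℝ → ℝ) (B : Set (Measure (Vec n × ℝ)))
    (w : Vec n) : EReal :=
  ⨆ Q ∈ B, ((∫ ξ, classLoss L w ξ ∂Q : ℝ) : EReal)

/-- The minimization of `G` over all `w` is equivalent to the minimization of `obj` over all
`(w, v) ∈ F` with auxiliary variables `v`: minimization over `v` alone gives back `G w` for every
`w`, the optimal values agree, and the optimal `w` are the same in both problems. -/
def IsEquivalentProgram {W V : Type*} (G : W → EReal) (F : Set (W × V)) (obj : W × V → ℝ) :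
    Prop :=
  (∀ w, G w = ⨅ v ∈ {v : V | (w, v) ∈ F}, ((obj (w, v) : ℝ) : EReal)) ∧
  (⨅ w, G w) = (⨅ z ∈ F, ((obj z : ℝ) : EReal)) ∧
  (∀ w, (∀ w', G w ≤ G w') ↔ ∃ v, (w, v) ∈ F ∧ ∀ z ∈ F, obj (w, v) ≤ obj z)

/-- Decision variables `(w, λ, s)` with `w ∈ ℝⁿ`, `λ ∈ ℝ` and `s ∈ ℝᴺ`, extended by further
variables from `V`. -/
abbrev Vars (n N : ℕ) (V : Type) : Type := Vec n × ℝ × (Fin N → ℝ) × V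

/-- The objective function `λρ + (1/N) ∑ᵢ sᵢ`. -/
noncomputable def objective {n N : ℕ} {V : Type} (ρ : ℝ) (z : Vars n N V) : ℝ :=
  z.2.1 * ρ + (1 / (N : ℝ)) * ∑ i, z.2.2.1 i

/-- The constraints of the program for the loss `L(z) = max_j (a_j z + b_j)`, in the variables
`w`, `lam`, `s`, `pp` (for `p⁺`) and `pm` (for `p⁻`). -/
def PiecewiseAffineConstraints {n N J : ℕ} (X : Set (Vec n)) (nrm : Seminorm ℝ (Vec n)) (κ : ℝ)
    (xhat : Fin N → Vec n) (yhat : Fin N → ℝ) (a b : Fin J → ℝ)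
    (w : Vec n) (lam : ℝ) (s : Fin N → ℝ) (pp pm : Fin N → Fin J → Vec n) : Prop :=
  ∀ i j,
    supportFun X ((a j * yhat i) • w - pp i j)
      + ((b j + inner ℝ (pp i j) (xhat i) : ℝ) : EReal) ≤ ((s i : ℝ) : EReal) ∧
    supportFun X (-((a j * yhat i) • w) - pm i j)
      + ((b j + inner ℝ (pm i j) (xhat i) - κ * lam : ℝ) : EReal) ≤ ((s i : ℝ) : EReal) ∧
    dualNorm nrm (pp i j) ≤ lam ∧
    dualNorm nrm (pm i j) ≤ lam

/-- The feasible set of the program for the loss `L(z) = max_j (a_j z + b_j)`. -/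
def piecewiseAffineFeasible {n N J : ℕ} (X : Set (Vec n)) (nrm : Seminorm ℝ (Vec n)) (κ : ℝ)
    (xhat : Fin N → Vec n) (yhat : Fin N → ℝ) (a b : Fin J → ℝ) :
    Set (Vars n N ((Fin N → Fin J → Vec n) × (Fin N → Fin J → Vec n))) :=
  {z | PiecewiseAffineConstraints X nrm κ xhat yhat a b
    z.1 z.2.1 z.2.2.1 z.2.2.2.1 z.2.2.2.2}

/-- The constraints of the program for a Lipschitz loss `L`, in the variables `w`, `lam`, `s`. -/
def LipschitzConstraints {n N : ℕ} (nrm : Seminorm ℝ (Vec n)) (κ : ℝ)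
    (xhat : Fin N → Vec n) (yhat : Fin N → ℝ) (L : ℝ → ℝ)
    (w : Vec n) (lam : ℝ) (s : Fin N → ℝ) : Prop :=
  (∀ i, L (yhat i * inner ℝ w (xhat i)) ≤ s i) ∧
  (∀ i, L (-yhat i * inner ℝ w (xhat i)) - κ * lam ≤ s i) ∧
  lipModulus L * dualNorm nrm w ≤ lam

/-- The feasible set of the program for a Lipschitz loss `L` (there are no further variables). -/
def lipschitzFeasible {n N : ℕ} (nrm : Seminorm ℝ (Vec n)) (κ : ℝ)
    (xhat : Fin N → Vec n) (yhat : Fin N → ℝ) (L : ℝ → ℝ) : Set (Vars n N Unit) :=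
  {z | LipschitzConstraints nrm κ xhat yhat L z.1 z.2.1 z.2.2.1}

end DRClassification

/-!
For fixed `w` the worst-case expected loss is a linear program over couplings with the empirical
distribution, and both programs are obtained from its dual
`inf {lam * ρ + (1/N) ∑ i, s i | 0 ≤ lam, f ξ - lam * d (ξ, ξhat i) ≤ s i for all i and ξ ∈ Ξ}`,
where `f = classLoss L w`; these constraints are `DualFeasible`.

Weak duality (`integral_le_of_dualFeasible`) integrates the constraint against a nearly optimal
coupling. For strong duality with dual attainment (`exists_dualFeasible_le`), let `V r` be the
worst-case expectation over the ball of radius `r`. Since couplings can be mixed, `V` is concave on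
`[0, ∞)`, and it is finite because the loss is Lipschitz. For `ρ > 0` a supergradient `lam` of `V`
at `ρ` exists; tested on uniform distributions over arbitrary points `ξ i ∈ Ξ`, whose distance from the
empirical distribution is at most the average of the costs `d (ξ i, ξhat i)`, its defining
inequality says exactly that the dual value at `lam` is at most `V ρ`. For `ρ = 0` the Lipschitz
property supplies a `lam` for which the constraints hold with `s i = f (ξhat i)`.

Dual attainment for every `w` turns weak duality into all the claimed equivalences
(`isEquivalentProgram_of_attained`), as soon as the projection of the feasible set to `(w, lam, s)`
is the set of dual constraints. For a piecewise affine loss this is a finite-dimensional separation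
argument (`exists_dualNorm_le_of_forall_le`), which converts the supremum over `x ∈ X` of an affine
function minus `lam * ‖x - x₀‖` into the support function of `X` at an attained `p` in the dual ball
of radius `lam`. For a convex Lipschitz loss on the whole space, the supremum over `x` is attained
at the sample if `lip(L) * ‖w‖_* ≤ lam`, and for `lam ≥ 0` it is infinite otherwise, because a
convex function of linear growth `μ` is `μ`-Lipschitz (`sub_le_mul_abs_of_growth`).
-/

namespace DRClassification

/-! ### The dual norm and the support function -/

lemma continuous_seminorm {n : ℕ} (nrm : Seminorm ℝ (Vec n)) : Continuous nrm := by
  have h := nrm.convexOn.continuousOn isOpen_univ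
  exact continuousOn_univ.mp h

/-- In finite dimension a definite seminorm dominates a multiple of the Euclidean norm; this is
what makes the dual norm finite. -/
lemma exists_norm_le_mul {n : ℕ} (nrm : Seminorm ℝ (Vec n)) (hnrm : ∀ x, nrm x = 0 → x = 0) :
    ∃ C : ℝ, 0 ≤ C ∧ ∀ x, ‖x‖ ≤ C * nrm x := by
  rcases (Metric.sphere (0 : Vec n) 1).eq_empty_or_nonempty with he | hne
  · refine ⟨0, le_rfl, fun x => ?_⟩
    by_contra! hx
    have hx0 : ‖x‖ ≠ 0 := by intro h; simp [h] at hx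
    have : (‖x‖⁻¹ • x) ∈ Metric.sphere (0 : Vec n) 1 := by
      simp [norm_smul, hx0]
    simp [he] at this
  · obtain ⟨x₀, hx₀, hmin⟩ := (isCompact_sphere (0 : Vec n) 1).exists_isMinOn hne
      (continuous_seminorm nrm).continuousOn
    have hx₀' : x₀ ≠ 0 := by
      rintro rfl
      simp at hx₀
    have hpos : 0 < nrm x₀ :=
      lt_of_le_of_ne (apply_nonneg nrm x₀) fun h => hx₀' (hnrm _ h.symm)
    refine ⟨(nrm x₀)⁻¹, by positivity, fun x => ?_⟩
    rcases eq_or_ne x 0 with rfl | hx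
    · simp
    have hx' : 0 < ‖x‖ := norm_pos_iff.mpr hx
    have hmem : (‖x‖⁻¹ • x) ∈ Metric.sphere (0 : Vec n) 1 := by
      simp [norm_smul, hx'.ne']
    have h := hmin hmem
    simp only [Set.mem_ofPred_eq, map_smul_eq_mul, norm_inv, norm_norm] at h
    rw [inv_mul_eq_div, le_div_iff₀ hpos]
    rw [inv_mul_eq_div, le_div_iff₀ hx'] at h
    linarith

lemma inner_le_dualNorm {n : ℕ} (nrm : Seminorm ℝ (Vec n)) (hnrm : ∀ x, nrm x = 0 → x = 0)
    {w x : Vec n} (hx : nrm x ≤ 1) : inner ℝ w x ≤ dualNorm nrm w := by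
  obtain ⟨C, hC, h⟩ := exists_norm_le_mul nrm hnrm
  refine le_csSup ⟨‖w‖ * C, ?_⟩ ⟨x, hx, rfl⟩
  rintro r ⟨u, hu, rfl⟩
  calc inner ℝ w u ≤ ‖w‖ * ‖u‖ := real_inner_le_norm _ _
    _ ≤ ‖w‖ * C := by
      gcongr
      exact (h u).trans (mul_le_of_le_one_right hC hu)

lemma dualNorm_nonneg {n : ℕ} (nrm : Seminorm ℝ (Vec n)) (hnrm : ∀ x, nrm x = 0 → x = 0)
    (w : Vec n) : 0 ≤ dualNorm nrm w := by
  simpa using inner_le_dualNorm nrm hnrm (w := w) (x := 0) (by simp)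

lemma inner_le_dualNorm_mul {n : ℕ} (nrm : Seminorm ℝ (Vec n)) (hnrm : ∀ x, nrm x = 0 → x = 0)
    (w x : Vec n) : inner ℝ w x ≤ dualNorm nrm w * nrm x := by
  rcases eq_or_ne x 0 with rfl | hx
  · simp
  have hpos : 0 < nrm x := lt_of_le_of_ne (apply_nonneg nrm x) fun h => hx (hnrm _ h.symm)
  have h := inner_le_dualNorm nrm hnrm (w := w) (x := (nrm x)⁻¹ • x)
    (by simp [map_smul_eq_mul, abs_of_pos hpos, hpos.ne'])
  rwa [inner_smul_right, inv_mul_eq_div, div_le_iff₀ hpos] at h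

lemma abs_inner_le_dualNorm_mul {n : ℕ} (nrm : Seminorm ℝ (Vec n)) (hnrm : ∀ x, nrm x = 0 → x = 0)
    (w x : Vec n) : |inner ℝ w x| ≤ dualNorm nrm w * nrm x := by
  refine abs_le'.mpr ⟨inner_le_dualNorm_mul nrm hnrm w x, ?_⟩
  simpa using inner_le_dualNorm_mul nrm hnrm w (-x)

lemma dualNorm_le {n : ℕ} (nrm : Seminorm ℝ (Vec n)) {w : Vec n} {c : ℝ}
    (h : ∀ x, nrm x ≤ 1 → inner ℝ w x ≤ c) :
    dualNorm nrm w ≤ c := by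
  refine csSup_le ⟨_, 0, by simp, rfl⟩ ?_
  rintro r ⟨u, hu, rfl⟩
  exact h u hu

lemma supportFun_add_coe_le_iff {n : ℕ} (X : Set (Vec n)) (z : Vec n) (r s : ℝ) :
    supportFun X z + (r : EReal) ≤ (s : EReal) ↔ ∀ x ∈ X, inner ℝ x z + r ≤ s := by
  rw [← EReal.le_sub_iff_add_le (by simp) (by simp), ← EReal.coe_sub, supportFun, iSup₂_le_iff]
  simp only [EReal.coe_le_coe_iff, le_sub_iff_add_le]

/-- Finite-dimensional conjugate duality: if the concave function `⟨c, x⟩ - β` lies below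
`lam * nrm (x - x₀)` on the convex set `X`, then a linear functional of dual norm at most `lam`
fits between the two. It comes from separating the open epigraph of `lam * nrm` from the
hypograph of the concave function. -/
lemma exists_dualNorm_le_of_forall_le {n : ℕ} (nrm : Seminorm ℝ (Vec n)) {X : Set (Vec n)}
    (hX : Convex ℝ X) (hXne : X.Nonempty) (c x₀ : Vec n) {lam β : ℝ} (hlam : 0 ≤ lam)
    (h : ∀ x ∈ X, inner ℝ c x - lam * nrm (x - x₀) ≤ β) :
    ∃ p : Vec n, dualNorm nrm p ≤ lam ∧ ∀ x ∈ X, inner ℝ x (c - p) + inner ℝ p x₀ ≤ β := by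
  have hconv : ConvexOn ℝ Set.univ fun u => lam * nrm u := nrm.convexOn.smul hlam
  have hA : Convex ℝ {q : Vec n × ℝ | lam * nrm q.1 < q.2} := by
    simpa using hconv.convex_strict_epigraph
  have hAo : IsOpen {q : Vec n × ℝ | lam * nrm q.1 < q.2} :=
    isOpen_lt (by have := continuous_seminorm nrm; fun_prop) continuous_snd
  have hB : Convex ℝ {q : Vec n × ℝ | q.1 + x₀ ∈ X ∧ q.2 ≤ inner ℝ c (q.1 + x₀) - β} := by
    rintro ⟨u, t⟩ ⟨hu, ht⟩ ⟨v, r⟩ ⟨hv, hr⟩ α γ hα hγ hαγ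
    have hsum : α • u + γ • v + x₀ = α • (u + x₀) + γ • (v + x₀) := by
      rw [smul_add, smul_add, add_add_add_comm, ← add_smul, hαγ, one_smul]
    refine ⟨?_, ?_⟩
    · change α • u + γ • v + x₀ ∈ X
      rw [hsum]
      exact hX hu hv hα hγ hαγ
    · change α * t + γ * r ≤ inner ℝ c (α • u + γ • v + x₀) - β
      rw [hsum, inner_add_right, inner_smul_right, inner_smul_right]
      have hβ : β = α * β + γ * β := by rw [← add_mul, hαγ, one_mul]
      have h1 := mul_le_mul_of_nonneg_left ht hα
      have h2 := mul_le_mul_of_nonneg_left hr hγ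
      simp only [mul_sub] at h1 h2
      linarith
  have hdisj : Disjoint {q : Vec n × ℝ | lam * nrm q.1 < q.2}
      {q : Vec n × ℝ | q.1 + x₀ ∈ X ∧ q.2 ≤ inner ℝ c (q.1 + x₀) - β} := by
    rw [Set.disjoint_left]
    rintro ⟨u, t⟩ hu ⟨hv, ht⟩
    have := h _ hv
    simp only [Set.mem_ofPred_eq, add_sub_cancel_right] at hu ht this
    linarith
  obtain ⟨f, σ, hfA, hfB⟩ := geometric_hahn_banach_open hA hAo hB hdisj
  set g : Vec n →L[ℝ] ℝ := f.comp (ContinuousLinearMap.inl ℝ (Vec n) ℝ) with hg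
  set m : ℝ := f (0, 1) with hm
  have hf : ∀ u t, f (u, t) = g u + t * m := by
    intro u t
    have : ((u, t) : Vec n × ℝ) = (u, 0) + t • (0, 1) := by simp
    rw [this, map_add, map_smul]
    simp [hg, hm]
  have hfA' : ∀ u t, lam * nrm u < t → g u + t * m < σ := fun u t hut => hf u t ▸ hfA (u, t) hut
  have hfB' : ∀ x ∈ X, σ ≤ g (x - x₀) + (inner ℝ c x - β) * m := by
    intro x hx
    have := hfB (x - x₀, inner ℝ c x - β) (by simp [hx])
    rwa [hf] at this
  obtain ⟨x₁, hx₁⟩ := hXne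
  -- The separating hyperplane is not vertical: the two sets overlap above `x₁ - x₀`.
  have hmneg : m < 0 := by
    have h1 := hfA' (x₁ - x₀) (lam * nrm (x₁ - x₀) + 1) (by linarith)
    have h2 := hfB' x₁ hx₁
    have h3 := h x₁ hx₁
    by_contra! hm0
    nlinarith
  have hle : ∀ u, g u + lam * nrm u * m ≤ σ := by
    intro u
    have hlim : Filter.Tendsto (fun t => g u + t * m)
        (nhdsWithin (lam * nrm u) (Set.Ioi (lam * nrm u)))
        (nhds (g u + lam * nrm u * m)) :=
      (Continuous.tendsto (by fun_prop) _).mono_left nhdsWithin_le_nhds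
    refine le_of_tendsto hlim ?_
    filter_upwards [self_mem_nhdsWithin] with t ht
    exact (hfA' u t ht).le
  have hσ : 0 ≤ σ := by simpa using hle 0
  -- A bounded positively homogeneous function is nonpositive.
  have hle0 : ∀ u, g u + lam * nrm u * m ≤ 0 := by
    intro u
    by_contra! hpos
    have h1 := hle (((σ + 1) / (g u + lam * nrm u * m)) • u)
    have h2 : 0 ≤ (σ + 1) / (g u + lam * nrm u * m) := by positivity
    rw [map_smul, map_smul_eq_mul, Real.norm_of_nonneg h2, smul_eq_mul] at h1
    have h3 : (σ + 1) / (g u + lam * nrm u * m) * (g u + lam * nrm u * m) = σ + 1 :=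
      div_mul_cancel₀ _ hpos.ne'
    nlinarith
  set p : Vec n := (-m)⁻¹ • (InnerProductSpace.toDual ℝ (Vec n)).symm g with hp
  have hpin : ∀ u, inner ℝ p u = (-m)⁻¹ * g u := by
    intro u
    simp [hp, inner_smul_left]
  have hm' : 0 < -m := by linarith
  refine ⟨p, dualNorm_le nrm fun u hu => ?_, fun x hx => ?_⟩
  · rw [hpin, inv_mul_eq_div, div_le_iff₀ hm']
    have h1 := hle0 u
    have h2 : lam * nrm u ≤ lam := mul_le_of_le_one_right hlam hu
    nlinarith
  · have h1 := hfB' x hx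
    have h2 : inner ℝ p (x - x₀) ≥ inner ℝ c x - β := by
      rw [hpin, inv_mul_eq_div, ge_iff_le, le_div_iff₀ hm']
      linarith
    rw [inner_sub_right] at h2
    rw [real_inner_comm, inner_sub_left]
    linarith

/-! ### Real functions of one variable -/

/-- A concave monotone function on `[0, ∞)` has a nonnegative supergradient at interior points. -/
lemma exists_supergradient {V : ℝ → ℝ} (hV : ConcaveOn ℝ (Set.Ici 0) V)
    (hmono : MonotoneOn V (Set.Ici 0)) {ρ : ℝ} (hρ : 0 < ρ) :
    ∃ lam : ℝ, 0 ≤ lam ∧ ∀ r, 0 ≤ r → V r ≤ V ρ + lam * (r - ρ) := by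
  -- The supremum of the slopes to the right of `ρ`.
  set S : Set ℝ := (fun r => (V r - V ρ) / (r - ρ)) '' Set.Ioi ρ with hS
  have hub : ∀ r, 0 ≤ r → r < ρ → (V ρ - V r) / (ρ - r) ∈ upperBounds S := by
    rintro r hr0 hr _ ⟨r', hr', rfl⟩
    exact hV.slope_anti_adjacent hr0 (hρ.le.trans (le_of_lt hr')) hr hr'
  have hne : S.Nonempty := ⟨_, ρ + 1, by simp, rfl⟩
  have hbdd : BddAbove S := ⟨_, hub 0 le_rfl hρ⟩
  refine ⟨sSup S, ?_, fun r hr => ?_⟩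
  · refine le_csSup_of_le hbdd ⟨ρ + 1, by simp, rfl⟩ ?_
    have := hmono (Set.mem_Ici.mpr hρ.le) (Set.mem_Ici.mpr (by linarith : 0 ≤ ρ + 1)) (by linarith)
    simpa using this
  · rcases lt_trichotomy r ρ with h | rfl | h
    · have h1 := csSup_le hne (hub r hr h)
      rw [le_div_iff₀ (by linarith)] at h1
      linarith
    · simp
    · have h1 : (V r - V ρ) / (r - ρ) ≤ sSup S := le_csSup hbdd ⟨r, h, rfl⟩
      rw [div_le_iff₀ (by linarith)] at h1
      linarith

lemma abs_sub_le_lipModulus_mul {L : ℝ → ℝ} {K : NNReal} (hK : LipschitzWith K L) (z z' : ℝ) :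
    |L z - L z'| ≤ lipModulus L * |z - z'| := by
  rcases eq_or_ne z z' with rfl | h
  · simp
  rw [← div_le_iff₀ (abs_pos.mpr (sub_ne_zero.mpr h))]
  refine le_csSup ⟨K, ?_⟩ ⟨z, z', h, rfl⟩
  rintro r ⟨u, v, huv, rfl⟩
  rw [div_le_iff₀ (abs_pos.mpr (sub_ne_zero.mpr huv))]
  simpa [Real.dist_eq] using hK.dist_le_mul u v

lemma lipModulus_nonneg (L : ℝ → ℝ) : 0 ≤ lipModulus L := by
  refine Real.sSup_nonneg ?_
  rintro r ⟨u, v, -, rfl⟩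
  positivity

lemma lipModulus_le {L : ℝ → ℝ} {μ : ℝ} (h : ∀ z z', |L z - L z'| ≤ μ * |z - z'|) :
    lipModulus L ≤ μ := by
  refine csSup_le ⟨_, 0, 1, by norm_num, rfl⟩ ?_
  rintro r ⟨u, v, huv, rfl⟩
  rw [div_le_iff₀ (abs_pos.mpr (sub_ne_zero.mpr huv))]
  exact h u v

/-- A convex function on the line of linear growth `μ` is Lipschitz with constant `μ`: a slope
exceeding `μ` would persist all the way to infinity. -/
lemma sub_le_mul_abs_of_growth {L : ℝ → ℝ} (hL : ConvexOn ℝ Set.univ L) {μ C z₀ : ℝ}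
    (hμ : 0 ≤ μ) (hgrow : ∀ z, L z ≤ C + μ * |z - z₀|) (z z' : ℝ) :
    L z' - L z ≤ μ * |z' - z| := by
  by_contra! hcon
  set δ := L z' - L z - μ * |z' - z| with hδ
  have hδ0 : 0 < δ := by linarith
  -- On the ray from `z` through `z'`, the excess over the growth rate `μ` is linear in `t`.
  have key : ∀ t : ℝ, 1 ≤ t → t * δ ≤ C + μ * |z - z₀| - L z := by
    intro t ht
    have ht0 : 0 < t := by linarith
    have h1 := hL.2 (Set.mem_univ z) (Set.mem_univ (z + t * (z' - z)))
      (sub_nonneg.mpr (inv_le_one_of_one_le₀ ht)) (inv_nonneg.mpr ht0.le) (by ring)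
    have h2 : (1 - t⁻¹) • z + t⁻¹ • (z + t * (z' - z)) = z' := by
      simp only [smul_eq_mul]
      field_simp
      ring
    rw [h2, smul_eq_mul, smul_eq_mul] at h1
    have h3 := mul_le_mul_of_nonneg_left h1 ht0.le
    have h4 : t * ((1 - t⁻¹) * L z + t⁻¹ * L (z + t * (z' - z)))
        = (t - 1) * L z + L (z + t * (z' - z)) := by
      field_simp
    have h5 : |z + t * (z' - z) - z₀| ≤ t * |z' - z| + |z - z₀| := by
      calc |z + t * (z' - z) - z₀| = |t * (z' - z) + (z - z₀)| := by ring_nf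
        _ ≤ |t * (z' - z)| + |z - z₀| := abs_add_le _ _
        _ = t * |z' - z| + |z - z₀| := by rw [abs_mul, abs_of_pos ht0]
    have h6 := mul_le_mul_of_nonneg_left h5 hμ
    have h7 := hgrow (z + t * (z' - z))
    rw [hδ]
    linarith
  have h0 : 0 ≤ |C + μ * |z - z₀| - L z| / δ := by positivity
  have h1 := key (|C + μ * |z - z₀| - L z| / δ + 1) (by linarith)
  rw [add_mul, div_mul_cancel₀ _ hδ0.ne'] at h1
  linarith [le_abs_self (C + μ * |z - z₀| - L z)]

/-- A finite maximum of affine functions is Lipschitz. -/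
lemma exists_lipschitzWith_of_eq_iSup {J : ℕ} (hJ : 0 < J) {L : ℝ → ℝ} {a b : Fin J → ℝ}
    (hL : ∀ z, L z = ⨆ j, (a j * z + b j)) : ∃ K, LipschitzWith K L := by
  have : Nonempty (Fin J) := ⟨⟨0, hJ⟩⟩
  refine ⟨_, LipschitzWith.of_le_add_mul (∑ j, ‖a j‖₊) fun z z' => ?_⟩
  rw [hL z, hL z']
  refine ciSup_le fun j => ?_
  have h1 : a j * z' + b j ≤ ⨆ j, (a j * z' + b j) :=
    le_ciSup (f := fun j => a j * z' + b j) (Set.finite_range _).bddAbove j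
  have h2 : |a j| ≤ ∑ j, |a j| :=
    Finset.single_le_sum (f := fun j => |a j|) (fun _ _ => abs_nonneg _) (Finset.mem_univ j)
  have h3 : a j * (z - z') ≤ (∑ j, |a j|) * |z - z'| := by
    calc a j * (z - z') ≤ |a j * (z - z')| := le_abs_self _
      _ = |a j| * |z - z'| := abs_mul _ _
      _ ≤ _ := by gcongr
  have h4 : ((∑ j, ‖a j‖₊ : NNReal) : ℝ) = ∑ j, |a j| := by push_cast; rfl
  rw [h4, Real.dist_eq]
  linarith

lemma ciSup_affine_le_iff {J : ℕ} (hJ : 0 < J) {L : ℝ → ℝ} {a b : Fin J → ℝ}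
    (hL : ∀ z, L z = ⨆ j, (a j * z + b j)) (z c : ℝ) : L z ≤ c ↔ ∀ j, a j * z + b j ≤ c := by
  have : Nonempty (Fin J) := ⟨⟨0, hJ⟩⟩
  rw [hL z]
  exact ciSup_le_iff (Set.finite_range _).bddAbove

/-! ### Couplings and the Wasserstein ball -/

lemma transportCost_nonneg {n : ℕ} (nrm : Seminorm ℝ (Vec n)) {κ : ℝ} (hκ : 0 ≤ κ)
    (ξ ξ' : Vec n × ℝ) : 0 ≤ transportCost nrm κ ξ ξ' := by
  unfold transportCost
  have := apply_nonneg nrm (ξ.1 - ξ'.1)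
  split_ifs <;> linarith

lemma nrm_sub_le_transportCost {n : ℕ} (nrm : Seminorm ℝ (Vec n)) {κ : ℝ} (hκ : 0 ≤ κ)
    (ξ ξ' : Vec n × ℝ) : nrm (ξ.1 - ξ'.1) ≤ transportCost nrm κ ξ ξ' := by
  unfold transportCost
  split_ifs <;> linarith

lemma transportCost_triangle {n : ℕ} (nrm : Seminorm ℝ (Vec n)) {κ : ℝ} (hκ : 0 ≤ κ)
    (ξ ξ' ξ'' : Vec n × ℝ) :
    transportCost nrm κ ξ ξ'' ≤ transportCost nrm κ ξ ξ' + transportCost nrm κ ξ' ξ'' := by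
  unfold transportCost
  have h1 : nrm (ξ.1 - ξ''.1) ≤ nrm (ξ.1 - ξ'.1) + nrm (ξ'.1 - ξ''.1) := by
    simpa using map_add_le_add nrm (ξ.1 - ξ'.1) (ξ'.1 - ξ''.1)
  by_cases h2 : ξ.2 = ξ'.2
  · simp only [h2, ne_eq, not_true_eq_false, if_false]
    linarith
  · simp only [ne_eq, h2, not_false_eq_true, if_true]
    split_ifs <;> linarith

@[simp]
lemma transportCost_self {n : ℕ} (nrm : Seminorm ℝ (Vec n)) (κ : ℝ) (ξ : Vec n × ℝ) :
    transportCost nrm κ ξ ξ = 0 := by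
  simp [transportCost]

lemma measurable_transportCost {n : ℕ} (nrm : Seminorm ℝ (Vec n)) (κ : ℝ) :
    Measurable fun ζ : (Vec n × ℝ) × (Vec n × ℝ) => transportCost nrm κ ζ.1 ζ.2 := by
  unfold transportCost
  have hn := (continuous_seminorm nrm).measurable
  refine Measurable.add (hn.comp (by fun_prop)) (Measurable.const_mul ?_ _)
  refine Measurable.ite ?_ measurable_const measurable_const
  exact (measurableSet_eq_fun (by fun_prop) (by fun_prop)).compl

lemma wasserstein_le_of_coupling {n : ℕ} (nrm : Seminorm ℝ (Vec n)) (κ : ℝ)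
    (π : Measure ((Vec n × ℝ) × (Vec n × ℝ))) :
    wasserstein nrm κ π.fst π.snd ≤ ∫⁻ ζ, ENNReal.ofReal (transportCost nrm κ ζ.1 ζ.2) ∂π :=
  iInf₂_le (f := fun (π : Measure ((Vec n × ℝ) × (Vec n × ℝ))) _ =>
    ∫⁻ ζ, ENNReal.ofReal (transportCost nrm κ ζ.1 ζ.2) ∂π) π ⟨rfl, rfl⟩

lemma exists_coupling_lt {n : ℕ} {nrm : Seminorm ℝ (Vec n)} {κ : ℝ}
    {Q P : Measure (Vec n × ℝ)} {c : ℝ≥0∞} (h : wasserstein nrm κ Q P < c) :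
    ∃ π : Measure ((Vec n × ℝ) × (Vec n × ℝ)), π.fst = Q ∧ π.snd = P ∧
      ∫⁻ ζ, ENNReal.ofReal (transportCost nrm κ ζ.1 ζ.2) ∂π < c := by
  unfold wasserstein at h
  simp only [iInf_lt_iff] at h
  obtain ⟨π, ⟨h1, h2⟩, h3⟩ := h
  exact ⟨π, h1, h2, h3⟩

/-- The Wasserstein distance is convex in its first argument: couplings can be mixed. -/
lemma wasserstein_mix_le {n : ℕ} (nrm : Seminorm ℝ (Vec n)) (κ : ℝ)
    (Q₁ Q₂ P : Measure (Vec n × ℝ)) {α β : ℝ≥0∞} (hαβ : α + β = 1) :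
    wasserstein nrm κ (α • Q₁ + β • Q₂) P ≤
      α * wasserstein nrm κ Q₁ P + β * wasserstein nrm κ Q₂ P := by
  rcases eq_or_ne (wasserstein nrm κ Q₁ P) ∞ with h₁ | h₁
  · rcases eq_or_ne α 0 with rfl | hα
    · rw [zero_add] at hαβ
      simp [hαβ]
    · simp [h₁, hα]
  rcases eq_or_ne (wasserstein nrm κ Q₂ P) ∞ with h₂ | h₂
  · rcases eq_or_ne β 0 with rfl | hβ
    · rw [add_zero] at hαβ
      simp [hαβ]
    · simp [h₂, hβ]
  refine ENNReal.le_of_forall_pos_le_add fun ε hε _ => ?_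
  have hε' : (ε : ℝ≥0∞) ≠ 0 := by exact_mod_cast hε.ne'
  obtain ⟨π₁, hf₁, hs₁, hc₁⟩ := exists_coupling_lt (ENNReal.lt_add_right h₁ hε')
  obtain ⟨π₂, hf₂, hs₂, hc₂⟩ := exists_coupling_lt (ENNReal.lt_add_right h₂ hε')
  have hfst : (α • π₁ + β • π₂).fst = α • Q₁ + β • Q₂ := by
    rw [Measure.fst, Measure.map_add _ _ measurable_fst, Measure.map_smul, Measure.map_smul,
      ← Measure.fst, ← Measure.fst, hf₁, hf₂]
  have hsnd : (α • π₁ + β • π₂).snd = P := by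
    rw [Measure.snd, Measure.map_add _ _ measurable_snd, Measure.map_smul, Measure.map_smul,
      ← Measure.snd, ← Measure.snd, hs₁, hs₂, ← add_smul, hαβ, one_smul]
  calc wasserstein nrm κ (α • Q₁ + β • Q₂) P
      ≤ ∫⁻ ζ, ENNReal.ofReal (transportCost nrm κ ζ.1 ζ.2) ∂(α • π₁ + β • π₂) := by
        simpa only [hfst, hsnd] using wasserstein_le_of_coupling nrm κ (α • π₁ + β • π₂)
    _ = α * ∫⁻ ζ, ENNReal.ofReal (transportCost nrm κ ζ.1 ζ.2) ∂π₁
        + β * ∫⁻ ζ, ENNReal.ofReal (transportCost nrm κ ζ.1 ζ.2) ∂π₂ := by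
        rw [lintegral_add_measure, lintegral_smul_measure, lintegral_smul_measure, smul_eq_mul,
          smul_eq_mul]
    _ ≤ α * (wasserstein nrm κ Q₁ P + ε) + β * (wasserstein nrm κ Q₂ P + ε) := by gcongr
    _ = α * wasserstein nrm κ Q₁ P + β * wasserstein nrm κ Q₂ P + (α + β) * ε := by ring
    _ = _ := by rw [hαβ, one_mul]

lemma wassersteinBall_mono {n : ℕ} (X : Set (Vec n)) (nrm : Seminorm ℝ (Vec n)) (κ : ℝ)
    (P : Measure (Vec n × ℝ)) {r r' : ℝ} (h : r ≤ r') :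
    wassersteinBall X nrm κ r P ⊆ wassersteinBall X nrm κ r' P :=
  fun _ hQ => ⟨hQ.1, hQ.2.1, hQ.2.2.trans (ENNReal.ofReal_le_ofReal h)⟩

lemma mix_mem_wassersteinBall {n : ℕ} {X : Set (Vec n)} {nrm : Seminorm ℝ (Vec n)} {κ : ℝ}
    {P : Measure (Vec n × ℝ)} {r₁ r₂ α β : ℝ} (hr₁ : 0 ≤ r₁) (hr₂ : 0 ≤ r₂) (hα : 0 ≤ α)
    (hβ : 0 ≤ β) (hαβ : α + β = 1) {Q₁ Q₂ : Measure (Vec n × ℝ)}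
    (h₁ : Q₁ ∈ wassersteinBall X nrm κ r₁ P) (h₂ : Q₂ ∈ wassersteinBall X nrm κ r₂ P) :
    ENNReal.ofReal α • Q₁ + ENNReal.ofReal β • Q₂
      ∈ wassersteinBall X nrm κ (α * r₁ + β * r₂) P := by
  obtain ⟨hp₁, hX₁, hW₁⟩ := h₁
  obtain ⟨hp₂, hX₂, hW₂⟩ := h₂
  have hsum : ENNReal.ofReal α + ENNReal.ofReal β = 1 := by
    rw [← ENNReal.ofReal_add hα hβ, hαβ, ENNReal.ofReal_one]
  refine ⟨⟨by simp [hsum]⟩, by simp [hX₁, hX₂, hsum], ?_⟩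
  refine (wasserstein_mix_le nrm κ Q₁ Q₂ P hsum).trans ?_
  rw [ENNReal.ofReal_add (by positivity) (by positivity), ENNReal.ofReal_mul hα,
    ENNReal.ofReal_mul hβ]
  gcongr

/-! ### Uniform distributions on finitely many points -/

/-- The uniform distribution on the points `ξ i`, counted with multiplicity. The empirical
distribution `empirical xhat yhat` unfolds to `uniformOnPoints fun i => (xhat i, yhat i)`. -/
noncomputable def uniformOnPoints {Ω : Type*} [MeasurableSpace Ω] {N : ℕ} (ξ : Fin N → Ω) :
    Measure Ω :=
  (N : ℝ≥0∞)⁻¹ • ∑ i, Measure.dirac (ξ i)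

lemma uniformOnPoints_eq_one {Ω : Type*} [MeasurableSpace Ω] {N : ℕ} (hN : 0 < N) {ξ : Fin N → Ω}
    {s : Set Ω} (hs : ∀ i, ξ i ∈ s) : uniformOnPoints ξ s = 1 := by
  have hN' : (N : ℝ≥0∞) ≠ 0 := by exact_mod_cast hN.ne'
  simp [uniformOnPoints, Measure.dirac_apply_of_mem (hs _), ENNReal.inv_mul_cancel hN']

lemma map_uniformOnPoints {Ω Ω' : Type*} [MeasurableSpace Ω] [MeasurableSpace Ω'] {N : ℕ}
    (ξ : Fin N → Ω) {f : Ω → Ω'} (hf : Measurable f) :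
    (uniformOnPoints ξ).map f = uniformOnPoints fun i => f (ξ i) := by
  rw [uniformOnPoints, Measure.map_smul, uniformOnPoints,
    ← Measure.mapₗ_apply_of_measurable hf, map_sum]
  simp [Measure.mapₗ_apply_of_measurable hf, Measure.map_dirac' hf]

lemma lintegral_uniformOnPoints {Ω : Type*} [MeasurableSpace Ω] {N : ℕ} (ξ : Fin N → Ω)
    {f : Ω → ℝ≥0∞} (hf : Measurable f) :
    ∫⁻ ω, f ω ∂(uniformOnPoints ξ) = (N : ℝ≥0∞)⁻¹ * ∑ i, f (ξ i) := by
  simp [uniformOnPoints, lintegral_dirac' _ hf]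

lemma integrable_uniformOnPoints {Ω : Type*} [MeasurableSpace Ω] [MeasurableSingletonClass Ω]
    {N : ℕ} (hN : 0 < N) (ξ : Fin N → Ω) (f : Ω → ℝ) : Integrable f (uniformOnPoints ξ) := by
  have hN' : (N : ℝ≥0∞) ≠ 0 := by exact_mod_cast hN.ne'
  refine Integrable.smul_measure ?_ (by simp [hN'])
  rw [integrable_finsetSum_measure]
  intro i _
  exact integrable_dirac (by simp)

lemma integral_uniformOnPoints {Ω : Type*} [MeasurableSpace Ω] [MeasurableSingletonClass Ω] {N : ℕ}
    (ξ : Fin N → Ω) (f : Ω → ℝ) :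
    ∫ ω, f ω ∂(uniformOnPoints ξ) = 1 / (N : ℝ) * ∑ i, f (ξ i) := by
  rw [uniformOnPoints, integral_smul_measure, integral_finsetSum_measure]
  · simp
  · intro i _
    exact integrable_dirac (by simp)

/-- Moving each sample `ξ' i` to `ξ i` costs the average of the individual costs. -/
lemma uniformOnPoints_mem_wassersteinBall {n N : ℕ} (hN : 0 < N) {X : Set (Vec n)}
    (nrm : Seminorm ℝ (Vec n)) {κ : ℝ} (hκ : 0 ≤ κ) {ξ : Fin N → Vec n × ℝ}
    (ξ' : Fin N → Vec n × ℝ) (hξ : ∀ i, ξ i ∈ inputOutput X) :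
    uniformOnPoints ξ ∈ wassersteinBall X nrm κ
      (1 / (N : ℝ) * ∑ i, transportCost nrm κ (ξ i) (ξ' i)) (uniformOnPoints ξ') := by
  refine ⟨⟨uniformOnPoints_eq_one hN fun _ => Set.mem_univ _⟩, uniformOnPoints_eq_one hN hξ, ?_⟩
  have h := wasserstein_le_of_coupling nrm κ (uniformOnPoints fun i => (ξ i, ξ' i))
  rw [lintegral_uniformOnPoints _ (measurable_transportCost nrm κ).ennreal_ofReal, Measure.fst,
    Measure.snd, map_uniformOnPoints _ measurable_fst, map_uniformOnPoints _ measurable_snd] at h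
  refine h.trans (le_of_eq ?_)
  have hN' : (0 : ℝ) < N := by exact_mod_cast hN
  rw [ENNReal.ofReal_mul (by positivity), one_div, ENNReal.ofReal_inv_of_pos hN',
    ENNReal.ofReal_natCast, ENNReal.ofReal_sum_of_nonneg fun i _ => transportCost_nonneg nrm hκ _ _]

/-! ### Weak duality -/

lemma integrable_transportCost {n : ℕ} (nrm : Seminorm ℝ (Vec n)) {κ : ℝ} (hκ : 0 ≤ κ)
    {π : Measure ((Vec n × ℝ) × (Vec n × ℝ))}
    (h : ∫⁻ ζ, ENNReal.ofReal (transportCost nrm κ ζ.1 ζ.2) ∂π ≠ ∞) :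
    Integrable (fun ζ => transportCost nrm κ ζ.1 ζ.2) π :=
  (lintegral_ofReal_ne_top_iff_integrable (measurable_transportCost nrm κ).aestronglyMeasurable
    (ae_of_all _ fun _ => transportCost_nonneg nrm hκ _ _)).mp h

lemma measurableSet_inputOutput {n : ℕ} {X : Set (Vec n)} (hX : IsClosed X) :
    MeasurableSet (inputOutput X) :=
  hX.measurableSet.prod (Set.toFinite _).measurableSet

lemma ae_mem_inputOutput {n : ℕ} {X : Set (Vec n)} (hX : IsClosed X) {nrm : Seminorm ℝ (Vec n)}
    {κ r : ℝ} {P Q : Measure (Vec n × ℝ)} (hQ : Q ∈ wassersteinBall X nrm κ r P) :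
    ∀ᵐ ξ ∂Q, ξ ∈ inputOutput X := by
  have := hQ.1
  exact (mem_ae_iff_prob_eq_one (measurableSet_inputOutput hX)).mpr hQ.2.1

/-- Distributions in a Wasserstein ball around a finitely supported one have a first moment. -/
lemma integrable_nrm_fst {n N : ℕ} (hN : 0 < N) {X : Set (Vec n)} {nrm : Seminorm ℝ (Vec n)}
    {κ : ℝ} (hκ : 0 ≤ κ) {r : ℝ} {ξhat : Fin N → Vec n × ℝ} {Q : Measure (Vec n × ℝ)}
    (hQ : Q ∈ wassersteinBall X nrm κ r (uniformOnPoints ξhat)) :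
    Integrable (fun ξ : Vec n × ℝ => nrm ξ.1) Q := by
  obtain ⟨π, hfst, hsnd, hcost⟩ := exists_coupling_lt (hQ.2.2.trans_lt ENNReal.ofReal_lt_top)
  have hn : Measurable fun ξ : Vec n × ℝ => nrm ξ.1 :=
    (continuous_seminorm nrm).measurable.comp measurable_fst
  have h2 : Integrable (fun ζ : (Vec n × ℝ) × (Vec n × ℝ) => nrm ζ.2.1) π := by
    have := integrable_uniformOnPoints hN ξhat fun ξ => nrm ξ.1
    rw [← hsnd, Measure.snd, integrable_map_measure hn.aestronglyMeasurable
      measurable_snd.aemeasurable] at this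
    exact this
  rw [← hfst, Measure.fst, integrable_map_measure hn.aestronglyMeasurable
    measurable_fst.aemeasurable]
  refine ((integrable_transportCost nrm hκ hcost.ne).add h2).mono'
    (hn.comp measurable_fst).aestronglyMeasurable (ae_of_all _ fun ζ => ?_)
  have h3 := nrm_sub_le_transportCost nrm hκ ζ.1 ζ.2
  have h4 : nrm ζ.1.1 ≤ nrm (ζ.1.1 - ζ.2.1) + nrm ζ.2.1 := by
    simpa using map_add_le_add nrm (ζ.1.1 - ζ.2.1) ζ.2.1
  simp only [Function.comp_apply, Pi.add_apply, Real.norm_of_nonneg (apply_nonneg nrm _)]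
  linarith

/-- The dual constraints for the worst-case expectation of `f`: the multiplier `lam` of the
transport budget is nonnegative, and `s i` bounds the penalized loss `f ξ - lam * d (ξ, ξhat i)`
over all input-output pairs `ξ`. -/
def DualFeasible {n N : ℕ} (X : Set (Vec n)) (nrm : Seminorm ℝ (Vec n)) (κ : ℝ)
    (ξhat : Fin N → Vec n × ℝ) (f : Vec n × ℝ → ℝ) (lam : ℝ) (s : Fin N → ℝ) : Prop :=
  0 ≤ lam ∧ ∀ i, ∀ ξ ∈ inputOutput X, f ξ - lam * transportCost nrm κ ξ (ξhat i) ≤ s i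

lemma integral_le_of_dualFeasible {n N : ℕ} (hN : 0 < N) {X : Set (Vec n)} (hX : IsClosed X)
    {nrm : Seminorm ℝ (Vec n)} {κ : ℝ} (hκ : 0 ≤ κ) {r : ℝ} (hr : 0 ≤ r)
    {ξhat : Fin N → Vec n × ℝ} {Q : Measure (Vec n × ℝ)}
    (hQ : Q ∈ wassersteinBall X nrm κ r (uniformOnPoints ξhat)) {f : Vec n × ℝ → ℝ}
    (hf : Integrable f Q) {lam : ℝ} {s : Fin N → ℝ} (h : DualFeasible X nrm κ ξhat f lam s) :
    ∫ ξ, f ξ ∂Q ≤ lam * r + 1 / (N : ℝ) * ∑ i, s i := by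
  obtain ⟨hlam, hs⟩ := h
  have hne : (Finset.univ : Finset (Fin N)).Nonempty := ⟨⟨0, hN⟩, Finset.mem_univ _⟩
  -- Samples may coincide while their `s i` differ, so the `s i` are replaced by the values of one
  -- measurable function `t` of the sample, which still dominates the penalized loss.
  set t : Vec n × ℝ → ℝ := fun ζ =>
    Finset.univ.inf' hne fun i => s i + lam * transportCost nrm κ ζ (ξhat i) with ht
  have htm : Measurable t := by
    have h0 : t = Finset.univ.inf' hne fun i ζ => s i + lam * transportCost nrm κ ζ (ξhat i) := by
      ext ζ
      simp [ht, Finset.inf'_apply]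
    rw [h0]
    refine Finset.inf'_induction hne _ (fun _ hf _ hg => hf.inf hg) fun i _ => ?_
    have h1 : Measurable fun ζ => transportCost nrm κ ζ (ξhat i) :=
      (measurable_transportCost nrm κ).comp
        (measurable_id.prodMk measurable_const : Measurable fun ζ => (ζ, ξhat i))
    exact (h1.const_mul lam).const_add _
  have hts : ∀ i, t (ξhat i) ≤ s i := fun i => by
    have := Finset.inf'_le (fun j => s j + lam * transportCost nrm κ (ξhat i) (ξhat j))
      (Finset.mem_univ i)
    simpa using this
  have hft : ∀ ξ ∈ inputOutput X, ∀ ζ, f ξ ≤ lam * transportCost nrm κ ξ ζ + t ζ := by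
    intro ξ hξ ζ
    rw [← sub_le_iff_le_add']
    refine Finset.le_inf' hne _ fun i _ => ?_
    have h1 := hs i ξ hξ
    have h2 := mul_le_mul_of_nonneg_left (transportCost_triangle nrm hκ ξ ζ (ξhat i)) hlam
    linarith
  -- Near-optimal couplings suffice.
  refine le_of_forall_pos_le_add fun ε hε => ?_
  have hδ : 0 < ε / (lam + 1) := by positivity
  obtain ⟨π, hfst, hsnd, hcost⟩ := exists_coupling_lt (hQ.2.2.trans_lt
    ((ENNReal.ofReal_lt_ofReal_iff (by positivity)).mpr (lt_add_of_pos_right r hδ)))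
  have hd := integrable_transportCost nrm hκ (hcost.trans ENNReal.ofReal_lt_top).ne
  have hdint : ∫ ζ, transportCost nrm κ ζ.1 ζ.2 ∂π ≤ r + ε / (lam + 1) := by
    rw [integral_eq_lintegral_of_nonneg_ae
      (ae_of_all _ fun _ => transportCost_nonneg nrm hκ _ _) hd.aestronglyMeasurable]
    exact ENNReal.toReal_le_of_le_ofReal (by positivity) hcost.le
  have hfπ : Integrable (fun ζ : (Vec n × ℝ) × (Vec n × ℝ) => f ζ.1) π := by
    rw [← hfst] at hf
    exact hf.comp_measurable measurable_fst
  have htπ : Integrable (fun ζ : (Vec n × ℝ) × (Vec n × ℝ) => t ζ.2) π := by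
    have := integrable_uniformOnPoints hN ξhat t
    rw [← hsnd] at this
    exact this.comp_measurable measurable_snd
  have hmem : ∀ᵐ ζ ∂π, ζ.1 ∈ inputOutput X := by
    have := ae_mem_inputOutput hX hQ
    rw [← hfst] at this
    exact ae_of_ae_map measurable_fst.aemeasurable this
  have htint : ∫ ζ, t ζ.2 ∂π = ∫ ξ, t ξ ∂(uniformOnPoints ξhat) := by
    rw [← hsnd, Measure.snd, integral_map measurable_snd.aemeasurable htm.aestronglyMeasurable]
  have hlamε : lam * (ε / (lam + 1)) ≤ ε := by
    rw [mul_div_assoc', div_le_iff₀ (by positivity)]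
    nlinarith
  calc ∫ ξ, f ξ ∂Q = ∫ ζ, f ζ.1 ∂π := by
        rw [← hfst] at hf ⊢
        rw [Measure.fst, integral_map measurable_fst.aemeasurable hf.aestronglyMeasurable]
    _ ≤ ∫ ζ, (lam * transportCost nrm κ ζ.1 ζ.2 + t ζ.2) ∂π := by
        refine integral_mono_ae hfπ ((hd.const_mul lam).add htπ) ?_
        filter_upwards [hmem] with ζ hζ
        exact hft ζ.1 hζ ζ.2
    _ = lam * ∫ ζ, transportCost nrm κ ζ.1 ζ.2 ∂π + 1 / (N : ℝ) * ∑ i, t (ξhat i) := by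
        rw [integral_add (hd.const_mul lam) htπ, integral_const_mul, htint,
          integral_uniformOnPoints]
    _ ≤ lam * (r + ε / (lam + 1)) + 1 / (N : ℝ) * ∑ i, s i := by
        gcongr with i
        exact hts i
    _ ≤ _ := by linarith

/-! ### Strong duality -/

/-- If `∑ i, g i (σ i) ≤ c` for all selections `σ`, then the suprema of the `g i` are finite and
their sum is at most `c`. -/
lemma exists_upper_bounds_of_selections {ι T : Type*} [Fintype ι] [Nonempty T] (g : ι → T → ℝ)
    (c : ℝ) (h : ∀ σ : ι → T, ∑ i, g i (σ i) ≤ c) :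
    ∃ s : ι → ℝ, (∀ i t, g i t ≤ s i) ∧ ∑ i, s i ≤ c := by
  classical
  obtain ⟨t₀⟩ := ‹Nonempty T›
  have hbdd : ∀ i, BddAbove (Set.range (g i)) := by
    intro i
    refine ⟨c - ∑ j ∈ Finset.univ.erase i, g j t₀, ?_⟩
    rintro _ ⟨t, rfl⟩
    have h1 := h (Function.update (fun _ => t₀) i t)
    rw [← Finset.add_sum_erase _ _ (Finset.mem_univ i)] at h1
    have h2 : ∑ j ∈ Finset.univ.erase i, g j (Function.update (fun _ => t₀) i t j)
        = ∑ j ∈ Finset.univ.erase i, g j t₀ := by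
      refine Finset.sum_congr rfl fun j hj => ?_
      rw [Function.update_of_ne (Finset.ne_of_mem_erase hj)]
    rw [h2, Function.update_self] at h1
    linarith
  refine ⟨fun i => ⨆ t, g i t, fun i t => le_ciSup (hbdd i) t, ?_⟩
  refine le_of_forall_pos_le_add fun ε hε => ?_
  set δ := ε / (Fintype.card ι + 1) with hδ
  have hδ0 : 0 < δ := by positivity
  have : Nonempty T := ⟨t₀⟩
  have hex : ∀ i, ∃ t, (⨆ t, g i t) - δ < g i t := fun i =>
    exists_lt_of_lt_ciSup (sub_lt_self _ hδ0)
  choose σ hσ using hex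
  have h1 : ∑ i, ((⨆ t, g i t) - δ) ≤ ∑ i, g i (σ i) := Finset.sum_le_sum fun i _ => (hσ i).le
  rw [Finset.sum_sub_distrib, Finset.sum_const, Finset.card_univ, nsmul_eq_mul] at h1
  have h2 : (Fintype.card ι : ℝ) * δ ≤ ε := by
    rw [hδ, mul_div_assoc', div_le_iff₀ (by positivity)]
    nlinarith
  linarith [h σ]

/-- Strong duality with dual attainment. For `ρ > 0` the multiplier is a supergradient at `ρ` of
the worst-case expectation as a function of the radius, which is concave because Wasserstein balls
mix; testing the supergradient inequality on uniform distributions decouples the samples. For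
`ρ = 0`, the multiplier is any `lam` for which moving a sample never pays. -/
lemma exists_dualFeasible_le {n N : ℕ} (hN : 0 < N) {X : Set (Vec n)} (hX : IsClosed X)
    {nrm : Seminorm ℝ (Vec n)} {κ : ℝ} (hκ : 0 ≤ κ) {ρ : ℝ} (hρ : 0 ≤ ρ)
    {ξhat : Fin N → Vec n × ℝ} (hξhat : ∀ i, ξhat i ∈ inputOutput X) {f : Vec n × ℝ → ℝ}
    (hf : ∀ r, ∀ Q ∈ wassersteinBall X nrm κ r (uniformOnPoints ξhat), Integrable f Q)
    (hgrow : ∃ lam, DualFeasible X nrm κ ξhat f lam fun i => f (ξhat i)) :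
    ∃ lam s, DualFeasible X nrm κ ξhat f lam s ∧
      ∀ c : ℝ, (∀ Q ∈ wassersteinBall X nrm κ ρ (uniformOnPoints ξhat), ∫ ξ, f ξ ∂Q ≤ c) →
        lam * ρ + 1 / (N : ℝ) * ∑ i, s i ≤ c := by
  obtain ⟨lam₀, hlam₀⟩ := hgrow
  have hN' : (0 : ℝ) < N := by exact_mod_cast hN
  have hcenter : ∀ r, 0 ≤ r →
      uniformOnPoints ξhat ∈ wassersteinBall X nrm κ r (uniformOnPoints ξhat) := by
    intro r hr
    refine wassersteinBall_mono X nrm κ _ ?_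
      (uniformOnPoints_mem_wassersteinBall hN nrm hκ ξhat hξhat)
    simpa using hr
  rcases hρ.eq_or_lt with rfl | hρ'
  · refine ⟨lam₀, _, hlam₀, fun c hc => ?_⟩
    have := hc _ (hcenter 0 le_rfl)
    rw [integral_uniformOnPoints] at this
    simpa using this
  set S : ℝ → Set ℝ := fun r =>
    (fun Q : Measure (Vec n × ℝ) => ∫ ξ, f ξ ∂Q) ''
      wassersteinBall X nrm κ r (uniformOnPoints ξhat) with hS
  have hbdd : ∀ r, 0 ≤ r → BddAbove (S r) := by
    intro r hr
    refine ⟨lam₀ * r + 1 / (N : ℝ) * ∑ i, f (ξhat i), ?_⟩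
    rintro _ ⟨Q, hQ, rfl⟩
    exact integral_le_of_dualFeasible hN hX hκ hr hQ (hf r Q hQ) hlam₀
  have hne : ∀ r, 0 ≤ r → (S r).Nonempty := fun r hr => ⟨_, _, hcenter r hr, rfl⟩
  have hmono : MonotoneOn (fun r => sSup (S r)) (Set.Ici 0) := fun r hr r' hr' hrr' =>
    csSup_le_csSup (hbdd r' hr') (hne r hr) (Set.image_mono (wassersteinBall_mono X nrm κ _ hrr'))
  have hconc : ConcaveOn ℝ (Set.Ici 0) fun r => sSup (S r) := by
    refine ⟨convex_Ici 0, fun r₁ hr₁ r₂ hr₂ α β hα hβ hαβ => ?_⟩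
    refine le_of_forall_pos_le_add fun ε hε => ?_
    obtain ⟨_, ⟨Q₁, hQ₁, rfl⟩, h₁⟩ :=
      exists_lt_of_lt_csSup (hne r₁ hr₁) (sub_lt_self (sSup (S r₁)) hε)
    obtain ⟨_, ⟨Q₂, hQ₂, rfl⟩, h₂⟩ :=
      exists_lt_of_lt_csSup (hne r₂ hr₂) (sub_lt_self (sSup (S r₂)) hε)
    have hmix := mix_mem_wassersteinBall hr₁ hr₂ hα hβ hαβ hQ₁ hQ₂
    have hle := le_csSup (hbdd _ (add_nonneg (mul_nonneg hα hr₁) (mul_nonneg hβ hr₂)))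
      (Set.mem_image_of_mem (fun Q : Measure (Vec n × ℝ) => ∫ ξ, f ξ ∂Q) hmix)
    simp only at hle h₁ h₂
    rw [integral_add_measure ((hf _ _ hQ₁).smul_measure ENNReal.ofReal_ne_top)
      ((hf _ _ hQ₂).smul_measure ENNReal.ofReal_ne_top), integral_smul_measure,
      integral_smul_measure, ENNReal.toReal_ofReal hα, ENNReal.toReal_ofReal hβ] at hle
    have h3 := mul_le_mul_of_nonneg_left h₁.le hα
    have h4 := mul_le_mul_of_nonneg_left h₂.le hβ
    have h5 : ε = α * ε + β * ε := by rw [← add_mul, hαβ, one_mul]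
    simp only [smul_eq_mul, mul_sub] at hle h3 h4 ⊢
    linarith
  obtain ⟨lam, hlam, hsup⟩ := exists_supergradient hconc hmono hρ'
  have : Nonempty (inputOutput X) := ⟨⟨ξhat ⟨0, hN⟩, hξhat _⟩⟩
  obtain ⟨s, hs, hsum⟩ := exists_upper_bounds_of_selections
    (fun (i : Fin N) (ξ : inputOutput X) => f ξ - lam * transportCost nrm κ ξ (ξhat i))
    (N * (sSup (S ρ) - lam * ρ)) (by
      intro σ
      set r := 1 / (N : ℝ) * ∑ i, transportCost nrm κ (σ i) (ξhat i) with hr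
      have hr0 : 0 ≤ r := mul_nonneg (by positivity)
        (Finset.sum_nonneg fun i _ => transportCost_nonneg nrm hκ _ _)
      have hmem := uniformOnPoints_mem_wassersteinBall hN nrm hκ (ξ := fun i => (σ i : Vec n × ℝ))
        ξhat fun i => (σ i).2
      have h1 := le_csSup (hbdd r hr0)
        (Set.mem_image_of_mem (fun Q : Measure (Vec n × ℝ) => ∫ ξ, f ξ ∂Q) hmem)
      have h2 := h1.trans (hsup r hr0)
      simp only [integral_uniformOnPoints] at h2
      rw [one_div, inv_mul_eq_div, div_le_iff₀ hN'] at h2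
      rw [Finset.sum_sub_distrib, ← Finset.mul_sum]
      have h3 : ∑ i, transportCost nrm κ (σ i) (ξhat i) = N * r := by
        rw [hr]
        field_simp
      rw [h3]
      linarith)
  refine ⟨lam, s, ⟨hlam, fun i ξ hξ => hs i ⟨ξ, hξ⟩⟩, fun c hc => ?_⟩
  have h1 : sSup (S ρ) ≤ c := by
    refine csSup_le (hne ρ hρ) ?_
    rintro _ ⟨Q, hQ, rfl⟩
    exact hc Q hQ
  have h2 : 1 / (N : ℝ) * ∑ i, s i ≤ sSup (S ρ) - lam * ρ := by
    rw [one_div, inv_mul_eq_div, div_le_iff₀ hN']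
    linarith
  linarith

/-! ### The loss of a linear classifier -/

lemma abs_label {y : ℝ} (hy : y ∈ ({1, -1} : Set ℝ)) : |y| = 1 := by
  rcases hy with rfl | rfl <;> simp

lemma neg_label_mem {y : ℝ} (hy : y ∈ ({1, -1} : Set ℝ)) : -y ∈ ({1, -1} : Set ℝ) := by
  rcases hy with rfl | rfl <;> simp

lemma integrable_classLoss {n N : ℕ} (hN : 0 < N) {X : Set (Vec n)} (hX : IsClosed X)
    {nrm : Seminorm ℝ (Vec n)} (hnrm : ∀ x, nrm x = 0 → x = 0) {κ : ℝ} (hκ : 0 ≤ κ) {r : ℝ}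
    {ξhat : Fin N → Vec n × ℝ} {Q : Measure (Vec n × ℝ)}
    (hQ : Q ∈ wassersteinBall X nrm κ r (uniformOnPoints ξhat)) {L : ℝ → ℝ} {K : NNReal}
    (hL : LipschitzWith K L) (w : Vec n) : Integrable (classLoss L w) Q := by
  have := hQ.1
  refine Integrable.mono' (g := fun ξ => |L 0| + K * (dualNorm nrm w * nrm ξ.1))
    ((integrable_const _).add (((integrable_nrm_fst hN hκ hQ).const_mul _).const_mul _)) ?_ ?_
  · have h1 := hL.continuous
    refine Continuous.aestronglyMeasurable ?_
    unfold classLoss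
    fun_prop
  · filter_upwards [ae_mem_inputOutput hX hQ] with ξ hξ
    have hy : |ξ.2| = 1 := abs_label hξ.2
    have h1 := hL.dist_le_mul (ξ.2 * inner ℝ w ξ.1) 0
    rw [Real.dist_eq, Real.dist_eq, sub_zero, abs_mul, hy, one_mul] at h1
    have h2 : (K : ℝ) * |inner ℝ w ξ.1| ≤ K * (dualNorm nrm w * nrm ξ.1) := by
      gcongr
      exact abs_inner_le_dualNorm_mul nrm hnrm w ξ.1
    have h3 := abs_sub_abs_le_abs_sub (L (ξ.2 * inner ℝ w ξ.1)) (L 0)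
    rw [Real.norm_eq_abs, classLoss]
    linarith

lemma eq_or_eq_neg_of_labels {y y' : ℝ} (hy : y ∈ ({1, -1} : Set ℝ))
    (hy' : y' ∈ ({1, -1} : Set ℝ)) : y = y' ∨ y = -y' ∧ y ≠ y' := by
  rcases hy with rfl | rfl <;> rcases hy' with rfl | rfl <;> norm_num

/-- For a Lipschitz loss, a large enough multiplier makes every move of a sample unprofitable. -/
lemma exists_dualFeasible_classLoss {n N : ℕ} {X : Set (Vec n)}
    {nrm : Seminorm ℝ (Vec n)} (hnrm : ∀ x, nrm x = 0 → x = 0) {κ : ℝ} (hκ : 0 < κ)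
    {ξhat : Fin N → Vec n × ℝ} (hξhat : ∀ i, ξhat i ∈ inputOutput X) {L : ℝ → ℝ} {K : NNReal}
    (hL : LipschitzWith K L) (w : Vec n) :
    ∃ lam, DualFeasible X nrm κ ξhat (classLoss L w) lam
      fun i => classLoss L w (ξhat i) := by
  have hD := dualNorm_nonneg nrm hnrm w
  -- The second summand pays for changing the label of a sample at unchanged input.
  refine ⟨K * dualNorm nrm w + (∑ i, 2 * K * |inner ℝ w (ξhat i).1|) / κ, by positivity,
    fun i ξ hξ => ?_⟩
  set M := ∑ i, 2 * K * |inner ℝ w (ξhat i).1| with hM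
  have hM0 : 0 ≤ M := by positivity
  have hMi : 2 * K * |inner ℝ w (ξhat i).1| ≤ M :=
    Finset.single_le_sum (f := fun i => 2 * (K : ℝ) * |inner ℝ w (ξhat i).1|)
      (fun _ _ => by positivity) (Finset.mem_univ i)
  have hy : |ξ.2| = 1 := abs_label hξ.2
  have h1 : classLoss L w ξ - classLoss L w (ξhat i)
      ≤ K * |ξ.2 * inner ℝ w ξ.1 - (ξhat i).2 * inner ℝ w (ξhat i).1| := by
    have := hL.dist_le_mul (ξ.2 * inner ℝ w ξ.1) ((ξhat i).2 * inner ℝ w (ξhat i).1)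
    rw [Real.dist_eq, Real.dist_eq] at this
    exact (le_abs_self _).trans this
  have h2 : (K : ℝ) * |inner ℝ w (ξ.1 - (ξhat i).1)|
      ≤ K * dualNorm nrm w * nrm (ξ.1 - (ξhat i).1) := by
    rw [mul_assoc]
    gcongr
    exact abs_inner_le_dualNorm_mul nrm hnrm w _
  have hmove : |ξ.2 * inner ℝ w (ξ.1 - (ξhat i).1)| = |inner ℝ w (ξ.1 - (ξhat i).1)| := by
    rw [abs_mul, hy, one_mul]
  have hnn := apply_nonneg nrm (ξ.1 - (ξhat i).1)
  rcases eq_or_eq_neg_of_labels hξ.2 (hξhat i).2 with h | ⟨h, hne⟩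
  · rw [← h, ← mul_sub, ← inner_sub_right, hmove] at h1
    have h3 : 0 ≤ M / κ * nrm (ξ.1 - (ξhat i).1) := by positivity
    simp only [transportCost, h, ne_eq, not_true_eq_false, if_false, mul_zero, add_zero]
    linarith
  · have h3 : ξ.2 * inner ℝ w ξ.1 - (ξhat i).2 * inner ℝ w (ξhat i).1
        = ξ.2 * inner ℝ w (ξ.1 - (ξhat i).1) + 2 * (ξ.2 * inner ℝ w (ξhat i).1) := by
      rw [inner_sub_right, h]
      ring
    have h4 : |ξ.2 * inner ℝ w ξ.1 - (ξhat i).2 * inner ℝ w (ξhat i).1|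
        ≤ |inner ℝ w (ξ.1 - (ξhat i).1)| + 2 * |inner ℝ w (ξhat i).1| := by
      rw [h3, ← hmove]
      refine (abs_add_le _ _).trans (le_of_eq ?_)
      rw [abs_mul 2, abs_mul _ (inner ℝ w (ξhat i).1), hy, one_mul, abs_two]
    have h5 := mul_le_mul_of_nonneg_left h4 K.coe_nonneg
    have h6 : 0 ≤ M / κ * nrm (ξ.1 - (ξhat i).1) := by positivity
    have h7 : M / κ * κ = M := div_mul_cancel₀ _ hκ.ne'
    have h8 : 0 ≤ K * dualNorm nrm w * κ := by positivity
    simp only [transportCost, hne, ne_eq, not_false_eq_true, if_true, mul_one]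
    linarith

/-- For a sample with label `±1`, the dual constraint splits into one constraint for each label:
keeping the label of the sample, and flipping it at the extra cost `κ`. -/
lemma forall_inputOutput_iff {n : ℕ} {X : Set (Vec n)} (nrm : Seminorm ℝ (Vec n)) (κ : ℝ)
    (L : ℝ → ℝ) (w : Vec n) (lam s : ℝ) {ξ' : Vec n × ℝ} (hξ' : ξ' ∈ inputOutput X) :
    (∀ ξ ∈ inputOutput X, classLoss L w ξ - lam * transportCost nrm κ ξ ξ' ≤ s) ↔
      ∀ x ∈ X, L (ξ'.2 * inner ℝ w x) - lam * nrm (x - ξ'.1) ≤ s ∧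
        L (-ξ'.2 * inner ℝ w x) - lam * nrm (x - ξ'.1) - κ * lam ≤ s := by
  have hneg := neg_label_mem hξ'.2
  have hne : -ξ'.2 ≠ ξ'.2 := by rcases hξ'.2 with h | h <;> rw [h] <;> norm_num
  constructor
  · intro h x hx
    have h1 := h (x, ξ'.2) ⟨hx, hξ'.2⟩
    have h2 := h (x, -ξ'.2) ⟨hx, hneg⟩
    simp only [classLoss, transportCost, ne_eq, not_true_eq_false, if_false, mul_zero,
      add_zero] at h1
    simp only [classLoss, transportCost, ne_eq, hne, not_false_eq_true, if_true, mul_one] at h2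
    exact ⟨h1, by linarith⟩
  · rintro h ⟨x, y⟩ ⟨hx, hy⟩
    obtain ⟨h1, h2⟩ := h x hx
    rcases eq_or_eq_neg_of_labels hy hξ'.2 with h3 | ⟨h3, -⟩
    · simp only at h3
      simpa [classLoss, transportCost, h3] using h1
    · simp only at h3
      simp only [classLoss, transportCost, h3, ne_eq, hne, not_false_eq_true, if_true, mul_one]
      linarith

/-! ### Equivalence of the programs -/

/-- If the objective bounds `G` from above on the feasible set, and `G w` is attained over every
fibre, then the two programs are equivalent. -/
lemma isEquivalentProgram_of_attained {W V : Type*} {G : W → EReal} {F : Set (W × V)}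
    {obj : W × V → ℝ} (hweak : ∀ z ∈ F, G z.1 ≤ (obj z : EReal))
    (hstrong : ∀ w, ∃ v, (w, v) ∈ F ∧ (obj (w, v) : EReal) ≤ G w) :
    IsEquivalentProgram G F obj := by
  refine ⟨fun w => ?_, ?_, fun w => ⟨fun h => ?_, ?_⟩⟩
  · obtain ⟨v, hv, hle⟩ := hstrong w
    exact le_antisymm (le_iInf₂ fun v hv => hweak (w, v) hv) ((iInf₂_le v hv).trans hle)
  · refine le_antisymm (le_iInf₂ fun z hz => (iInf_le G z.1).trans (hweak z hz))
      (le_iInf fun w => ?_)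
    obtain ⟨v, hv, hle⟩ := hstrong w
    exact (iInf₂_le (w, v) hv).trans hle
  · obtain ⟨v, hv, hle⟩ := hstrong w
    exact ⟨v, hv, fun z hz => EReal.coe_le_coe_iff.mp ((hle.trans (h z.1)).trans (hweak z hz))⟩
  · rintro ⟨v, hv, hopt⟩ w'
    obtain ⟨v', hv', hle⟩ := hstrong w'
    exact ((hweak _ hv).trans (EReal.coe_le_coe_iff.mpr (hopt _ hv'))).trans hle

/-- Every feasible set whose projection to `(w, lam, s)` is described by the dual constraints of
the worst-case expected loss gives an equivalent program. -/
lemma isEquivalentProgram_of_dualFeasible {n N : ℕ} {V : Type} (hN : 0 < N) {X : Set (Vec n)}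
    (hX : IsClosed X) {nrm : Seminorm ℝ (Vec n)} (hnrm : ∀ x, nrm x = 0 → x = 0) {κ : ℝ}
    (hκ : 0 < κ) {ρ : ℝ} (hρ : 0 ≤ ρ) {ξhat : Fin N → Vec n × ℝ}
    (hξhat : ∀ i, ξhat i ∈ inputOutput X) {L : ℝ → ℝ} {K : NNReal} (hL : LipschitzWith K L)
    {F : Set (Vars n N V)}
    (hF : ∀ w lam s, (∃ v, (w, lam, s, v) ∈ F) ↔
      DualFeasible X nrm κ ξhat (classLoss L w) lam s) :
    IsEquivalentProgram (worstCaseLoss L (wassersteinBall X nrm κ ρ (uniformOnPoints ξhat))) F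
      (objective ρ) := by
  have hint := fun w r Q (hQ : Q ∈ wassersteinBall X nrm κ r (uniformOnPoints ξhat)) =>
    integrable_classLoss hN hX hnrm hκ.le hQ hL w
  have hweak : ∀ w lam s, DualFeasible X nrm κ ξhat (classLoss L w) lam s →
      worstCaseLoss L (wassersteinBall X nrm κ ρ (uniformOnPoints ξhat)) w
        ≤ ((lam * ρ + 1 / (N : ℝ) * ∑ i, s i : ℝ) : EReal) := by
    intro w lam s h
    refine iSup₂_le fun Q hQ => EReal.coe_le_coe_iff.mpr ?_
    exact integral_le_of_dualFeasible hN hX hκ.le hρ hQ (hint w ρ Q hQ) h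
  refine isEquivalentProgram_of_attained ?_ fun w => ?_
  · rintro ⟨w, lam, s, v⟩ hz
    exact hweak w lam s ((hF w lam s).mp ⟨v, hz⟩)
  · obtain ⟨lam, s, hfeas, hle⟩ := exists_dualFeasible_le hN hX hκ.le hρ hξhat (hint w)
      (exists_dualFeasible_classLoss hnrm hκ hξhat hL w)
    obtain ⟨v, hv⟩ := (hF w lam s).mpr hfeas
    refine ⟨(lam, s, v), hv, ?_⟩
    refine EReal.le_of_forall_lt_iff_le.mp fun c hc =>
      EReal.coe_le_coe_iff.mpr (hle c fun Q hQ => ?_)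
    refine EReal.coe_le_coe_iff.mp (le_trans ?_ hc.le)
    exact le_iSup₂ (f := fun (Q : Measure (Vec n × ℝ)) _ =>
      ((∫ ξ, classLoss L w ξ ∂Q : ℝ) : EReal)) Q hQ

lemma convexOn_objective {n N : ℕ} {V : Type} [AddCommGroup V] [Module ℝ V] (ρ : ℝ)
    {F : Set (Vars n N V)} (hF : Convex ℝ F) : ConvexOn ℝ F (objective ρ) := by
  refine ⟨hF, fun z _ z' _ α β _ _ _ => le_of_eq ?_⟩
  simp only [objective, Prod.fst_add, Prod.snd_add, Prod.smul_fst, Prod.smul_snd, Pi.add_apply,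
    Pi.smul_apply, smul_eq_mul, Finset.sum_add_distrib, ← Finset.mul_sum]
  ring

/-! ### Piecewise affine losses -/

lemma piecewiseAffineConstraints_iff {n N J : ℕ} {X : Set (Vec n)} {nrm : Seminorm ℝ (Vec n)}
    {κ : ℝ} {xhat : Fin N → Vec n} {yhat : Fin N → ℝ} {a b : Fin J → ℝ} {w : Vec n} {lam : ℝ}
    {s : Fin N → ℝ} {pp pm : Fin N → Fin J → Vec n} :
    PiecewiseAffineConstraints X nrm κ xhat yhat a b w lam s pp pm ↔
      ∀ i j, (∀ x ∈ X, inner ℝ x ((a j * yhat i) • w - pp i j)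
          + (b j + inner ℝ (pp i j) (xhat i)) ≤ s i) ∧
        (∀ x ∈ X, inner ℝ x (-((a j * yhat i) • w) - pm i j)
          + (b j + inner ℝ (pm i j) (xhat i) - κ * lam) ≤ s i) ∧
        dualNorm nrm (pp i j) ≤ lam ∧ dualNorm nrm (pm i j) ≤ lam := by
  simp only [PiecewiseAffineConstraints, supportFun_add_coe_le_iff]

/-- The dual norm balls `dualNorm p ≤ lam` form a convex set of pairs `(p, lam)`. -/
lemma dualNorm_add_smul_le {n : ℕ} (nrm : Seminorm ℝ (Vec n))
    (hnrm : ∀ x, nrm x = 0 → x = 0) {p q : Vec n} {lam μ α β : ℝ} (hα : 0 ≤ α) (hβ : 0 ≤ β)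
    (hp : dualNorm nrm p ≤ lam) (hq : dualNorm nrm q ≤ μ) :
    dualNorm nrm (α • p + β • q) ≤ α * lam + β * μ := by
  refine dualNorm_le nrm fun x hx => ?_
  rw [inner_add_left, real_inner_smul_left, real_inner_smul_left]
  have h1 := (inner_le_dualNorm nrm hnrm (w := p) hx).trans hp
  have h2 := (inner_le_dualNorm nrm hnrm (w := q) hx).trans hq
  gcongr

lemma convex_piecewiseAffineFeasible {n N J : ℕ} (X : Set (Vec n)) (nrm : Seminorm ℝ (Vec n))
    (hnrm : ∀ x, nrm x = 0 → x = 0) (κ : ℝ) (xhat : Fin N → Vec n) (yhat : Fin N → ℝ)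
    (a b : Fin J → ℝ) : Convex ℝ (piecewiseAffineFeasible X nrm κ xhat yhat a b) := by
  rintro ⟨w, lam, s, pp, pm⟩ hz ⟨w', lam', s', pp', pm'⟩ hz' α β hα hβ hαβ
  have hz := piecewiseAffineConstraints_iff.mp hz
  have hz' := piecewiseAffineConstraints_iff.mp hz'
  refine piecewiseAffineConstraints_iff.mpr fun i j => ?_
  obtain ⟨h1, h2, h3, h4⟩ := hz i j
  obtain ⟨h1', h2', h3', h4'⟩ := hz' i j
  have hβ' : β = 1 - α := by linarith
  refine ⟨fun x hx => ?_, fun x hx => ?_, dualNorm_add_smul_le nrm hnrm hα hβ h3 h3',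
    dualNorm_add_smul_le nrm hnrm hα hβ h4 h4'⟩
  · have e1 := mul_le_mul_of_nonneg_left (h1 x hx) hα
    have e2 := mul_le_mul_of_nonneg_left (h1' x hx) hβ
    simp only [Prod.fst_add, Prod.snd_add, Prod.smul_fst, Prod.smul_snd, Pi.add_apply,
      Pi.smul_apply, smul_eq_mul, inner_add_left, inner_add_right, inner_sub_right,
      inner_smul_right, real_inner_smul_left] at e1 e2 ⊢
    refine le_trans (le_of_eq ?_) (add_le_add e1 e2)
    rw [hβ']
    ring
  · have e1 := mul_le_mul_of_nonneg_left (h2 x hx) hα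
    have e2 := mul_le_mul_of_nonneg_left (h2' x hx) hβ
    simp only [Prod.fst_add, Prod.snd_add, Prod.smul_fst, Prod.smul_snd, Pi.add_apply,
      Pi.smul_apply, smul_eq_mul, inner_add_left, inner_add_right, inner_sub_right,
      inner_neg_right, inner_smul_right, real_inner_smul_left] at e1 e2 ⊢
    refine le_trans (le_of_eq ?_) (add_le_add e1 e2)
    rw [hβ']
    ring

/-- Eliminating `p⁺` and `p⁻` from the program leaves the dual constraints: each affine piece of
the loss is separated from the transport cost by a linear functional. -/
lemma exists_piecewiseAffineConstraints_iff {n N J : ℕ} (hN : 0 < N) (hJ : 0 < J)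
    {X : Set (Vec n)} (hXconvex : Convex ℝ X) {nrm : Seminorm ℝ (Vec n)}
    (hnrm : ∀ x, nrm x = 0 → x = 0) (κ : ℝ) {xhat : Fin N → Vec n} {yhat : Fin N → ℝ}
    (hdata : ∀ i, (xhat i, yhat i) ∈ inputOutput X) {L : ℝ → ℝ} {a b : Fin J → ℝ}
    (hL : ∀ z, L z = ⨆ j, (a j * z + b j)) (w : Vec n) (lam : ℝ) (s : Fin N → ℝ) :
    (∃ pp pm, PiecewiseAffineConstraints X nrm κ xhat yhat a b w lam s pp pm) ↔
      DualFeasible X nrm κ (fun i => (xhat i, yhat i)) (classLoss L w) lam s := by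
  simp only [piecewiseAffineConstraints_iff, DualFeasible, forall_inputOutput_iff _ _ _ _ _ _
    (hdata _)]
  simp only [sub_le_iff_le_add, ciSup_affine_le_iff hJ hL]
  constructor
  · rintro ⟨pp, pm, h⟩
    refine ⟨(dualNorm_nonneg nrm hnrm _).trans (h ⟨0, hN⟩ ⟨0, hJ⟩).2.2.1, fun i x hx =>
      ⟨fun j => ?_, fun j => ?_⟩⟩
    · have h1 := (h i j).1 x hx
      have h2 := inner_le_dualNorm_mul nrm hnrm (pp i j) (x - xhat i)
      have h3 := mul_le_mul_of_nonneg_right (h i j).2.2.1 (apply_nonneg nrm (x - xhat i))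
      rw [inner_sub_right, real_inner_smul_right, real_inner_comm w x,
        real_inner_comm (pp i j) x] at h1
      rw [inner_sub_right] at h2
      linarith
    · have h1 := (h i j).2.1 x hx
      have h2 := inner_le_dualNorm_mul nrm hnrm (pm i j) (x - xhat i)
      have h3 := mul_le_mul_of_nonneg_right (h i j).2.2.2 (apply_nonneg nrm (x - xhat i))
      rw [inner_sub_right, inner_neg_right, real_inner_smul_right, real_inner_comm w x,
        real_inner_comm (pm i j) x] at h1
      rw [inner_sub_right] at h2
      linarith
  · rintro ⟨hlam, h⟩
    have hne : X.Nonempty := ⟨_, (hdata ⟨0, hN⟩).1⟩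
    have hpp : ∀ i j, ∃ p, dualNorm nrm p ≤ lam ∧ ∀ x ∈ X,
        inner ℝ x ((a j * yhat i) • w - p) + inner ℝ p (xhat i) ≤ s i - b j := fun i j =>
      exists_dualNorm_le_of_forall_le nrm hXconvex hne _ _ hlam fun x hx => by
        have := (h i x hx).1 j
        rw [real_inner_smul_left]
        linarith
    have hpm : ∀ i j, ∃ p, dualNorm nrm p ≤ lam ∧ ∀ x ∈ X,
        inner ℝ x (-((a j * yhat i) • w) - p) + inner ℝ p (xhat i) ≤ s i - b j + κ * lam :=
      fun i j => exists_dualNorm_le_of_forall_le nrm hXconvex hne _ _ hlam fun x hx => by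
        have := (h i x hx).2 j
        rw [inner_neg_left, real_inner_smul_left]
        linarith
    choose pp hpp1 hpp2 using hpp
    choose pm hpm1 hpm2 using hpm
    refine ⟨pp, pm, fun i j => ⟨fun x hx => ?_, fun x hx => ?_, hpp1 i j, hpm1 i j⟩⟩
    · linarith [hpp2 i j x hx]
    · linarith [hpm2 i j x hx]

/-! ### Lipschitz losses -/

/-- A convex loss penalized by `lam * nrm (x - x₀)` is bounded above on the whole space only if
`lam` is at least the product of the Lipschitz modulus with the dual norm. -/
lemma lipModulus_mul_dualNorm_le {n : ℕ} {nrm : Seminorm ℝ (Vec n)}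
    {L : ℝ → ℝ} (hL : ConvexOn ℝ Set.univ L) {w x₀ : Vec n}
    {lam s y : ℝ} (hlam : 0 ≤ lam) (hy : |y| = 1)
    (h : ∀ x, L (y * inner ℝ w x) - lam * nrm (x - x₀) ≤ s) :
    lipModulus L * dualNorm nrm w ≤ lam := by
  have key : ∀ u, nrm u ≤ 1 → inner ℝ w u * lipModulus L ≤ lam := by
    intro u hu
    rcases le_or_gt (inner ℝ w u) 0 with hd | hd
    · exact (mul_nonpos_of_nonpos_of_nonneg hd (lipModulus_nonneg L)).trans hlam
    rw [mul_comm, ← le_div_iff₀ hd]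
    have hy2 : y * y = 1 := by rw [← abs_mul_abs_self, hy, one_mul]
    -- Along the line `x₀ + t • u`, every real number is a value of `y * ⟨w, x⟩`.
    have hgrow : ∀ z, L z ≤ s + lam / inner ℝ w u * |z - y * inner ℝ w x₀| := by
      intro z
      set t := y * (z - y * inner ℝ w x₀) / inner ℝ w u with ht
      have h1 := h (x₀ + t • u)
      have h2 : y * inner ℝ w (x₀ + t • u) = z := by
        rw [inner_add_right, real_inner_smul_right, ht, div_mul_cancel₀ _ hd.ne']
        linear_combination (z - y * inner ℝ w x₀) * hy2
      have h3 : |t| = |z - y * inner ℝ w x₀| / inner ℝ w u := by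
        rw [ht, abs_div, abs_mul, hy, one_mul, abs_of_pos hd]
      have h4 : nrm (x₀ + t • u - x₀) ≤ |t| := by
        rw [add_sub_cancel_left, map_smul_eq_mul, Real.norm_eq_abs]
        exact mul_le_of_le_one_right (abs_nonneg t) hu
      have h5 := mul_le_mul_of_nonneg_left h4 hlam
      rw [h2] at h1
      rw [h3, mul_div_assoc', ← div_mul_eq_mul_div] at h5
      linarith
    have hle := sub_le_mul_abs_of_growth hL (div_nonneg hlam hd.le) hgrow
    refine lipModulus_le fun z z' => abs_le'.mpr ⟨hle z' z, ?_⟩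
    rw [neg_sub, abs_sub_comm]
    exact hle z z'
  rcases (lipModulus_nonneg L).eq_or_lt with h0 | h0
  · rw [← h0, zero_mul]
    exact hlam
  · rw [mul_comm, ← le_div_iff₀ h0]
    exact dualNorm_le nrm fun u hu => (le_div_iff₀ h0).mpr (key u hu)

lemma lipschitzConstraints_iff {n N : ℕ} (hN : 0 < N) {nrm : Seminorm ℝ (Vec n)}
    (hnrm : ∀ x, nrm x = 0 → x = 0) (κ : ℝ) {xhat : Fin N → Vec n} {yhat : Fin N → ℝ}
    (hdata : ∀ i, (xhat i, yhat i) ∈ inputOutput (Set.univ : Set (Vec n))) {L : ℝ → ℝ}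
    (hL : ConvexOn ℝ Set.univ L) {K : NNReal} (hK : LipschitzWith K L) (w : Vec n) (lam : ℝ)
    (s : Fin N → ℝ) :
    LipschitzConstraints nrm κ xhat yhat L w lam s ↔
      DualFeasible Set.univ nrm κ (fun i => (xhat i, yhat i)) (classLoss L w) lam s := by
  have hy : ∀ i, |yhat i| = 1 := fun i => abs_label (hdata i).2
  simp only [LipschitzConstraints, DualFeasible, forall_inputOutput_iff _ _ _ _ _ _ (hdata _),
    Set.mem_univ, forall_const]
  have hD := dualNorm_nonneg nrm hnrm w
  constructor
  · rintro ⟨h1, h2, h3⟩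
    -- Moving the input changes the loss by at most the change of the penalty.
    have hmove : ∀ y : ℝ, |y| = 1 → ∀ x x',
        L (y * inner ℝ w x) ≤ L (y * inner ℝ w x') + lam * nrm (x - x') := by
      intro y hy x x'
      have e1 := (le_abs_self _).trans
        (abs_sub_le_lipModulus_mul hK (y * inner ℝ w x) (y * inner ℝ w x'))
      rw [← mul_sub, ← inner_sub_right, abs_mul, hy, one_mul] at e1
      have e2 := mul_le_mul_of_nonneg_left (abs_inner_le_dualNorm_mul nrm hnrm w (x - x'))
        (lipModulus_nonneg L)
      have e3 := mul_le_mul_of_nonneg_right h3 (apply_nonneg nrm (x - x'))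
      linarith
    refine ⟨(mul_nonneg (lipModulus_nonneg L) hD).trans h3, fun i x => ⟨?_, ?_⟩⟩
    · linarith [h1 i, hmove (yhat i) (hy i) x (xhat i)]
    · linarith [h2 i, hmove (-yhat i) (by rw [abs_neg, hy]) x (xhat i)]
  · rintro ⟨hlam, h⟩
    refine ⟨fun i => ?_, fun i => ?_, ?_⟩
    · simpa using (h i (xhat i)).1
    · simpa using (h i (xhat i)).2
    · exact lipModulus_mul_dualNorm_le hL hlam (hy ⟨0, hN⟩) fun x => (h ⟨0, hN⟩ x).1

lemma convex_lipschitzFeasible {n N : ℕ} {nrm : Seminorm ℝ (Vec n)}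
    (hnrm : ∀ x, nrm x = 0 → x = 0) (κ : ℝ) (xhat : Fin N → Vec n) (yhat : Fin N → ℝ)
    {L : ℝ → ℝ} (hL : ConvexOn ℝ Set.univ L) :
    Convex ℝ (lipschitzFeasible nrm κ xhat yhat L) := by
  rintro ⟨w, lam, s, u⟩ ⟨h1, h2, h3⟩ ⟨w', lam', s', u'⟩ ⟨h1', h2', h3'⟩ α β hα hβ hαβ
  have hcomb : ∀ y x, L (y * inner ℝ (α • w + β • w') x)
      ≤ α * L (y * inner ℝ w x) + β * L (y * inner ℝ w' x) := by
    intro y x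
    have := hL.2 (Set.mem_univ (y * inner ℝ w x)) (Set.mem_univ (y * inner ℝ w' x)) hα hβ hαβ
    simp only [smul_eq_mul] at this
    rwa [inner_add_left, real_inner_smul_left, real_inner_smul_left, mul_add, mul_left_comm y,
      mul_left_comm y]
  refine ⟨fun i => ?_, fun i => ?_, ?_⟩
  · have e1 := mul_le_mul_of_nonneg_left (h1 i) hα
    have e2 := mul_le_mul_of_nonneg_left (h1' i) hβ
    exact (hcomb _ _).trans (add_le_add e1 e2)
  · have e1 := mul_le_mul_of_nonneg_left (h2 i) hα
    have e2 := mul_le_mul_of_nonneg_left (h2' i) hβ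
    have e3 := hcomb (-yhat i) (xhat i)
    simp only [Prod.fst_add, Prod.snd_add, Prod.smul_fst, Prod.smul_snd, Pi.add_apply,
      Pi.smul_apply, smul_eq_mul, mul_sub] at e1 e2 e3 ⊢
    linarith
  · have e1 := mul_le_mul_of_nonneg_left h3 hα
    have e2 := mul_le_mul_of_nonneg_left h3' hβ
    have e3 := mul_le_mul_of_nonneg_left
      (dualNorm_add_smul_le nrm hnrm hα hβ (le_refl (dualNorm nrm w)) (le_refl (dualNorm nrm w')))
      (lipModulus_nonneg L)
    simp only [Prod.fst_add, Prod.snd_add, Prod.smul_fst, Prod.smul_snd, smul_eq_mul]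
      at e1 e2 e3 ⊢
    linarith

end DRClassification

open DRClassification in
theorem mainTheorem2 (n N : ℕ) (hN : 0 < N)
    (X : Set (DRClassification.Vec n)) (hXconvex : Convex ℝ X) (hXclosed : IsClosed X)
    (nrm : Seminorm ℝ (DRClassification.Vec n)) (hnrm : ∀ x, nrm x = 0 → x = 0)
    (κ : ℝ) (hκ : 0 < κ) (ρ : ℝ) (hρ : 0 ≤ ρ)
    (xhat : Fin N → DRClassification.Vec n) (yhat : Fin N → ℝ)
    (hdata : ∀ i, (xhat i, yhat i) ∈ DRClassification.inputOutput X)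
    (L : ℝ → ℝ) (hL : ConvexOn ℝ Set.univ L) :
    -- (i) piecewise affine loss
    (∀ (J : ℕ) (_ : 0 < J) (a b : Fin J → ℝ), (∀ z, L z = ⨆ j, (a j * z + b j)) →
      (∀ w, ∀ Q ∈ DRClassification.wassersteinBall X nrm κ ρ
          (DRClassification.empirical xhat yhat),
        MeasureTheory.Integrable (DRClassification.classLoss L w) Q) ∧
      ConvexOn ℝ (DRClassification.piecewiseAffineFeasible X nrm κ xhat yhat a b)
        (DRClassification.objective ρ) ∧
      DRClassification.IsEquivalentProgram
        (DRClassification.worstCaseLoss L (DRClassification.wassersteinBall X nrm κ ρ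
          (DRClassification.empirical xhat yhat)))
        (DRClassification.piecewiseAffineFeasible X nrm κ xhat yhat a b)
        (DRClassification.objective ρ)) ∧
    -- (ii) unconstrained inputs and Lipschitz continuous loss
    (X = Set.univ → (∃ K, LipschitzWith K L) →
      (∀ w, ∀ Q ∈ DRClassification.wassersteinBall X nrm κ ρ
          (DRClassification.empirical xhat yhat),
        MeasureTheory.Integrable (DRClassification.classLoss L w) Q) ∧
      ConvexOn ℝ (DRClassification.lipschitzFeasible nrm κ xhat yhat L)
        (DRClassification.objective ρ) ∧
      DRClassification.IsEquivalentProgram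
        (DRClassification.worstCaseLoss L (DRClassification.wassersteinBall X nrm κ ρ
          (DRClassification.empirical xhat yhat)))
        (DRClassification.lipschitzFeasible nrm κ xhat yhat L)
        (DRClassification.objective ρ)) := by
  refine ⟨fun J hJ a b hab => ?_, ?_⟩
  · obtain ⟨K, hK⟩ := exists_lipschitzWith_of_eq_iSup hJ hab
    refine ⟨fun w Q hQ => integrable_classLoss hN hXclosed hnrm hκ.le hQ hK w,
      convexOn_objective ρ (convex_piecewiseAffineFeasible X nrm hnrm κ xhat yhat a b),
      isEquivalentProgram_of_dualFeasible hN hXclosed hnrm hκ hρ hdata hK fun w lam s => ?_⟩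
    rw [← exists_piecewiseAffineConstraints_iff hN hJ hXconvex hnrm κ hdata hab w lam s]
    exact Prod.exists
  · rintro rfl ⟨K, hK⟩
    refine ⟨fun w Q hQ => integrable_classLoss hN hXclosed hnrm hκ.le hQ hK w,
      convexOn_objective ρ (convex_lipschitzFeasible hnrm κ xhat yhat hL),
      isEquivalentProgram_of_dualFeasible hN hXclosed hnrm hκ hρ hdata hK fun w lam s => ?_⟩
    rw [← lipschitzConstraints_iff hN hnrm κ hdata hL hK w lam s]
    exact ⟨fun ⟨_, h⟩ => h, fun h => ⟨(), h⟩⟩
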